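/- **Lemma 4.1.** Let $\kappa>0$, $M\ge 0$, $s\in\mathbb N=\{0,1,2,\dots\}$ and $\lambda\ge 0$ be constants, put $d\nu:=2\cot^3x\,dx$ on $(0,\tfrac\pi2)$ and $$L(s,\lambda):=-\frac{d^2}{dx^2}+3(\tan x+\cot x)\frac{d}{dx}+\frac{s(s+2)}{\cos^2x}+\frac{M^2+\lambda}{\kappa\sin^2x},\qquad c:=\Big(4+\frac{M^2+\lambda}{\kappa}\Big)^{1/2}.$$ Let $\mathcal L^0(s,\lambda)$ be the operator in the complex Hilbert space $L^2((0,\tfrac\pi2),d\nu)$ with domain $C_0^\infty((0,\tfrac\pi2))$ that acts by $L(s,\lambda)$. Then $\mathcal L^0(s,\lambda)$ is essentially self-adjoint. Let $\mathcal L$ be its closure. For $i\in\mathbb N$ put $$f_i(x):=\bigg(\frac{(2i+s+c+2)\,i!\,\Gamma(i+s+c+2)}{(i+s+1)!\,\Gamma(i+c+1)}\bigg)^{1/2}\cos^{s}x\,\sin^{2+c}x\,P_i^{(s+1,c)}(-\cos2x),\qquad \Omega_i:=(2i+s+c+2)^2,$$ where $P_i^{(a,b)}$ are the Jacobi polynomials.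 The functions $f_i$ form an orthonormal basis of $L^2((0,\tfrac\pi2),d\nu)$, each $f_i$ lies in the domain of $\mathcal L$, and $\mathcal Lf_i=\Omega_if_i$. The operator $\mathcal L$ has a unique bounded continuous functional calculus on $[0,\infty)$, that is, there is exactly one unital $*$-homomorphism $F\mapsto F(\mathcal L)$ from the bounded continuous functions $[0,\infty)\to\mathbb C$ to the bounded operators on $L^2((0,\tfrac\pi2),d\nu)$ that maps $t\mapsto(t-z)^{-1}$ to $(\mathcal L-z)^{-1}$ for every $z\in\mathbb C\setminus[0,\infty)$. For every bounded continuous $F:[0,\infty)\to\mathbb C$ and every $f\in L^2((0,\tfrac\pi2),d\nu)$, $$F(\mathcal L)f=\sum_{i\in\mathbb N}F(\Omega_i)\bigg(\int_0^{\pi/2}f(x')\,\overline{f_i(x')}\,d\nu(x')\bigg)f_i,$$ with (unconditional) convergence in $L^2((0,\tfrac\pi2),d\nu)$. -/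

import Mathlib

open MeasureTheory Set
open scoped NNReal BoundedContinuousFunction Distributions

noncomputable section

/-- The open interval `(0, π/2)`. -/
def radialInterval : TopologicalSpace.Opens ℝ := ⟨Ioo 0 (Real.pi / 2), isOpen_Ioo⟩

/-- The measure `dν = 2 cot³ x dx` on `(0, π/2)`. -/
def radialMeasure : Measure ℝ :=
  (volume.restrict (Ioo 0 (Real.pi / 2))).withDensity
    (fun x => ENNReal.ofReal (2 * Real.cot x ^ 3))

/-- The complex Hilbert space `L²((0, π/2), dν)`. -/
abbrev RadialL2 : Type := Lp ℂ 2 radialMeasure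

/-- The zeroth order coefficient `s(s+2)/cos² x + (M²+λ)/(κ sin² x)`. -/
def radialPotential (κ M : ℝ) (s : ℕ) (lam x : ℝ) : ℝ :=
  (s : ℝ) * (s + 2) / Real.cos x ^ 2 + (M ^ 2 + lam) / (κ * Real.sin x ^ 2)

/-- The differential expression
`L(s,λ) f = -f'' + 3 (tan x + cot x) f' + (s(s+2)/cos² x + (M²+λ)/(κ sin² x)) f`. -/
def radialExpr (κ M : ℝ) (s : ℕ) (lam : ℝ) (f : ℝ → ℂ) (x : ℝ) : ℂ :=
  -deriv (deriv f) x + ((3 * (Real.tan x + Real.cot x) : ℝ) : ℂ) * deriv f x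
    + (radialPotential κ M s lam x : ℂ) * f x

/-! ### Helper facts: smooth compactly supported functions lie in `L²(dν)` -/

theorem continuousOn_cot_radial : ContinuousOn Real.cot (Ioo 0 (Real.pi / 2)) := by
  have h : Real.cot = fun x => Real.cos x / Real.sin x := by
    funext x
    exact Real.cot_eq_cos_div_sin x
  rw [h]
  refine Real.continuous_cos.continuousOn.div Real.continuous_sin.continuousOn ?_
  intro x hx
  exact (Real.sin_pos_of_pos_of_lt_pi hx.1 (by linarith [hx.2, Real.pi_pos])).ne'

theorem memLp_radial_of_compact {g : ℝ → ℂ} {K : Set ℝ} (hK : IsCompact K)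
    (hKI : K ⊆ Ioo 0 (Real.pi / 2)) (hg : ContinuousOn g (Ioo 0 (Real.pi / 2)))
    (h0 : ∀ x ∉ K, g x = 0) : MemLp g 2 radialMeasure := by
  have hfin : radialMeasure K < ⊤ := by
    obtain ⟨C, hC⟩ := hK.exists_bound_of_continuousOn (continuousOn_cot_radial.mono hKI)
    have hC' : ∀ x ∈ K, ENNReal.ofReal (2 * Real.cot x ^ 3) ≤ ENNReal.ofReal (2 * C ^ 3) := by
      intro x hx
      apply ENNReal.ofReal_le_ofReal
      have h1 := hC x hx
      have h2 : |Real.cot x ^ 3| ≤ C ^ 3 := by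
        rw [abs_pow]
        exact pow_le_pow_left₀ (abs_nonneg _) h1 3
      linarith [le_abs_self (Real.cot x ^ 3)]
    rw [radialMeasure, withDensity_apply _ hK.measurableSet]
    calc ∫⁻ x in K, ENNReal.ofReal (2 * Real.cot x ^ 3) ∂(volume.restrict (Ioo 0 (Real.pi / 2)))
        ≤ ∫⁻ _ in K, ENNReal.ofReal (2 * C ^ 3) ∂(volume.restrict (Ioo 0 (Real.pi / 2))) :=
          setLIntegral_mono measurable_const hC'
      _ = ENNReal.ofReal (2 * C ^ 3) * (volume.restrict (Ioo 0 (Real.pi / 2))) K := by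
          rw [setLIntegral_const]
      _ < ⊤ := by
          refine ENNReal.mul_lt_top ENNReal.ofReal_lt_top ?_
          exact lt_of_le_of_lt (Measure.restrict_apply_le _ _) hK.measure_lt_top
  obtain ⟨C, hC⟩ := hK.exists_bound_of_continuousOn (hg.mono hKI)
  have hind : g = K.indicator g := by
    funext x
    by_cases hx : x ∈ K
    · rw [indicator_of_mem hx]
    · rw [indicator_of_notMem hx, h0 x hx]
  rw [hind, memLp_indicator_iff_restrict hK.measurableSet]
  have : IsFiniteMeasure (radialMeasure.restrict K) := ⟨by simpa using hfin⟩
  refine MemLp.of_bound ((hg.mono hKI).aestronglyMeasurable hK.measurableSet) C ?_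
  exact (ae_restrict_iff' hK.measurableSet).2 (Filter.Eventually.of_forall hC)

theorem memLp_testFunction (φ : 𝓓(radialInterval, ℂ)) : MemLp φ 2 radialMeasure :=
  memLp_radial_of_compact φ.hasCompactSupport φ.tsupport_subset φ.continuous.continuousOn
    (fun _ hx => image_eq_zero_of_notMem_tsupport hx)

theorem contDiff_testFunction (φ : 𝓓(radialInterval, ℂ)) : ContDiff ℝ 2 φ :=
  φ.contDiff.of_le
    (show ((2 : ℕ∞) : WithTop ℕ∞) ≤ ((⊤ : ℕ∞) : WithTop ℕ∞) from WithTop.coe_le_coe.2 le_top)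

theorem memLp_radialExpr (κ M : ℝ) (s : ℕ) (lam : ℝ) (φ : 𝓓(radialInterval, ℂ)) :
    MemLp (radialExpr κ M s lam φ) 2 radialMeasure := by
  have hd1 : ContDiff ℝ 1 (deriv φ) := by
    have h := contDiff_testFunction φ
    rw [show (2 : WithTop ℕ∞) = 1 + 1 by norm_num, contDiff_succ_iff_deriv] at h
    exact h.2.2
  have hd2 : Continuous (deriv (deriv φ)) := hd1.continuous_deriv (le_refl _)
  have hcos : ∀ x ∈ Ioo 0 (Real.pi / 2), Real.cos x ≠ 0 := fun x hx =>
    (Real.cos_pos_of_mem_Ioo ⟨by linarith [hx.1, Real.pi_pos], hx.2⟩).ne'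
  have hsin : ∀ x ∈ Ioo 0 (Real.pi / 2), Real.sin x ≠ 0 := fun x hx =>
    (Real.sin_pos_of_pos_of_lt_pi hx.1 (by linarith [hx.2, Real.pi_pos])).ne'
  have htan : ContinuousOn Real.tan (Ioo 0 (Real.pi / 2)) :=
    Real.continuousOn_tan.mono (fun x hx => hcos x hx)
  have hA : ContinuousOn (fun x => 3 * (Real.tan x + Real.cot x)) (Ioo 0 (Real.pi / 2)) :=
    continuousOn_const.mul (htan.add continuousOn_cot_radial)
  have hV : ContinuousOn (radialPotential κ M s lam) (Ioo 0 (Real.pi / 2)) := by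
    have h1 : ContinuousOn (fun x => (s : ℝ) * (s + 2) / Real.cos x ^ 2) (Ioo 0 (Real.pi / 2)) :=
      continuousOn_const.div (Real.continuous_cos.pow 2).continuousOn
        (fun x hx => pow_ne_zero 2 (hcos x hx))
    have h2 : ContinuousOn (fun x => (M ^ 2 + lam) / (κ * Real.sin x ^ 2))
        (Ioo 0 (Real.pi / 2)) := by
      have h3 : ContinuousOn (fun x => (M ^ 2 + lam) / κ / Real.sin x ^ 2)
          (Ioo 0 (Real.pi / 2)) :=
        continuousOn_const.div (Real.continuous_sin.pow 2).continuousOn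
          (fun x hx => pow_ne_zero 2 (hsin x hx))
      refine h3.congr (fun x _ => ?_)
      exact (div_div _ _ _).symm
    exact h1.add h2
  have t1 : tsupport (deriv φ) ⊆ tsupport φ := tsupport_deriv_subset
  have t2 : tsupport (deriv (deriv φ)) ⊆ tsupport φ := (tsupport_deriv_subset).trans t1
  refine memLp_radial_of_compact φ.hasCompactSupport φ.tsupport_subset ?_ ?_
  · exact (hd2.neg.continuousOn.add
      ((Complex.continuous_ofReal.comp_continuousOn hA).mul hd1.continuous.continuousOn)).add
      ((Complex.continuous_ofReal.comp_continuousOn hV).mul φ.continuous.continuousOn)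
  · intro x hx
    rw [radialExpr, image_eq_zero_of_notMem_tsupport hx,
      image_eq_zero_of_notMem_tsupport (fun h => hx (t1 h)),
      image_eq_zero_of_notMem_tsupport (fun h => hx (t2 h))]
    simp

/-! ### The minimal operator -/

/-- The inclusion `C₀^∞((0, π/2)) → L²(dν)`. -/
def testToL2 : 𝓓(radialInterval, ℂ) →ₗ[ℂ] RadialL2 where
  toFun φ := (memLp_testFunction φ).toLp φ
  map_add' _ _ := rfl
  map_smul' _ _ := rfl

theorem radialExpr_add (κ M : ℝ) (s : ℕ) (lam : ℝ) (φ ψ : 𝓓(radialInterval, ℂ)) :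
    radialExpr κ M s lam (φ + ψ : 𝓓(radialInterval, ℂ))
      = radialExpr κ M s lam φ + radialExpr κ M s lam ψ := by
  have hφ := contDiff_testFunction φ
  have hψ := contDiff_testFunction ψ
  have e1 : deriv (φ + ψ : 𝓓(radialInterval, ℂ)) = deriv φ + deriv ψ := by
    funext x
    exact deriv_add (hφ.differentiable (by norm_num) x) (hψ.differentiable (by norm_num) x)
  have d1 : ∀ χ : 𝓓(radialInterval, ℂ), Differentiable ℝ (deriv χ) := by
    intro χ
    have h := contDiff_testFunction χ
    rw [show (2 : WithTop ℕ∞) = 1 + 1 by norm_num, contDiff_succ_iff_deriv] at h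
    exact h.2.2.differentiable (by norm_num)
  funext x
  have e2 : deriv (deriv φ + deriv ψ) x = deriv (deriv φ) x + deriv (deriv ψ) x :=
    deriv_add (d1 φ x) (d1 ψ x)
  have e0 : (φ + ψ : 𝓓(radialInterval, ℂ)) x = φ x + ψ x := rfl
  simp only [radialExpr, Pi.add_apply, e1, e2, e0]
  ring

theorem radialExpr_smul (κ M : ℝ) (s : ℕ) (lam : ℝ) (c : ℂ) (φ : 𝓓(radialInterval, ℂ)) :
    radialExpr κ M s lam (c • φ : 𝓓(radialInterval, ℂ)) = c • radialExpr κ M s lam φ := by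
  have e1 : deriv (c • φ : 𝓓(radialInterval, ℂ)) = fun x => c * deriv φ x := by
    funext x
    exact deriv_const_mul_field c
  have e0 : ∀ x, (c • φ : 𝓓(radialInterval, ℂ)) x = c * φ x := fun _ => rfl
  funext x
  have e2 : deriv (fun y => c * deriv φ y) x = c * deriv (deriv φ) x := deriv_const_mul_field c
  simp only [radialExpr, Pi.smul_apply, smul_eq_mul, e1, e2, e0]
  ring

/-- The map `φ ↦ L(s,λ) φ` from `C₀^∞((0, π/2))` to `L²(dν)`. -/
def radialExprToL2 (κ M : ℝ) (s : ℕ) (lam : ℝ) : 𝓓(radialInterval, ℂ) →ₗ[ℂ] RadialL2 where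
  toFun φ := (memLp_radialExpr κ M s lam φ).toLp _
  map_add' φ ψ := by
    rw [← MemLp.toLp_add]
    exact MemLp.toLp_congr _ _ (Filter.Eventually.of_forall
      (fun x => congrFun (radialExpr_add κ M s lam φ ψ) x))
  map_smul' c φ := by
    rw [RingHom.id_apply, ← MemLp.toLp_const_smul]
    exact MemLp.toLp_congr _ _ (Filter.Eventually.of_forall
      (fun x => congrFun (radialExpr_smul κ M s lam c φ) x))

theorem cot_pos_radial {x : ℝ} (hx : x ∈ Ioo 0 (Real.pi / 2)) : 0 < Real.cot x := by
  rw [Real.cot_eq_cos_div_sin]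
  exact div_pos (Real.cos_pos_of_mem_Ioo ⟨by linarith [hx.1, Real.pi_pos], hx.2⟩)
    (Real.sin_pos_of_pos_of_lt_pi hx.1 (by linarith [hx.2, Real.pi_pos]))

theorem testToL2_injective : Function.Injective testToL2 := by
  rw [← LinearMap.ker_eq_bot, LinearMap.ker_eq_bot']
  intro φ hφ
  have h1 : (φ : ℝ → ℂ) =ᵐ[radialMeasure] 0 := by
    have h := (memLp_testFunction φ).coeFn_toLp
    have h' : (memLp_testFunction φ).toLp φ = 0 := hφ
    rw [h'] at h
    exact h.symm.trans (Lp.coeFn_zero _ _ _)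
  have hmeas : AEMeasurable (fun x => ENNReal.ofReal (2 * Real.cot x ^ 3))
      (volume.restrict (Ioo 0 (Real.pi / 2))) :=
    ((continuousOn_const.mul (continuousOn_cot_radial.pow 3)).aemeasurable
      measurableSet_Ioo).ennreal_ofReal
  have h2 : (φ : ℝ → ℂ) =ᵐ[volume.restrict (Ioo 0 (Real.pi / 2))] 0 := by
    have h3 := (ae_withDensity_iff' hmeas).1 h1
    filter_upwards [h3, ae_restrict_mem measurableSet_Ioo] with x hx hxI
    apply hx
    have := cot_pos_radial hxI
    rw [Ne, ENNReal.ofReal_eq_zero, not_le]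
    positivity
  have h4 : EqOn (φ : ℝ → ℂ) 0 (Ioo 0 (Real.pi / 2)) :=
    Measure.eqOn_open_of_ae_eq h2 isOpen_Ioo φ.continuous.continuousOn continuousOn_const
  ext x
  by_cases hx : x ∈ Ioo 0 (Real.pi / 2)
  · exact h4 hx
  · exact image_eq_zero_of_notMem_tsupport (fun h => hx (φ.tsupport_subset h))

/-- The operator `ℒ⁰(s,λ)` in `L²((0, π/2), dν)` with domain `C₀^∞((0, π/2))` that acts by
`L(s,λ)`. -/
def radialOp (κ M : ℝ) (s : ℕ) (lam : ℝ) : RadialL2 →ₗ.[ℂ] RadialL2 where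
  domain := LinearMap.range testToL2
  toFun := (radialExprToL2 κ M s lam).comp
    (LinearEquiv.ofInjective testToL2 testToL2_injective).symm.toLinearMap

/-- On (the class of) a test function `φ` the operator is given by the differential expression. -/
theorem radialOp_apply (κ M : ℝ) (s : ℕ) (lam : ℝ) (φ : 𝓓(radialInterval, ℂ)) :
    radialOp κ M s lam ⟨testToL2 φ, LinearMap.mem_range_self _ φ⟩
      = (memLp_radialExpr κ M s lam φ).toLp _ := by
  have h : (LinearEquiv.ofInjective testToL2 testToL2_injective).symm
      ⟨testToL2 φ, LinearMap.mem_range_self _ φ⟩ = φ := by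
    rw [LinearEquiv.symm_apply_eq]
    rfl
  change radialExprToL2 κ M s lam ((LinearEquiv.ofInjective testToL2 testToL2_injective).symm
      ⟨testToL2 φ, LinearMap.mem_range_self _ φ⟩) = _
  rw [h]
  rfl

/-! ### Unbounded operators -/

section Unbounded

variable {H : Type*} [NormedAddCommGroup H] [InnerProductSpace ℂ H] [CompleteSpace H]

/-- `A` is essentially self-adjoint: it is densely defined and closable, and its closure is
self-adjoint. -/
structure IsEssentiallySelfAdjoint (A : H →ₗ.[ℂ] H) : Prop where
  dense_domain : Dense (A.domain : Set H)
  isClosable : A.IsClosable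
  isSelfAdjoint_closure : IsSelfAdjoint A.closure

/-- The bounded operator `R` is the resolvent `(A - z)⁻¹`. -/
structure IsResolventAt (A : H →ₗ.[ℂ] H) (z : ℂ) (R : H →L[ℂ] H) : Prop where
  right_inv : ∀ v : H, ∃ h : R v ∈ A.domain, A ⟨R v, h⟩ - z • R v = v
  left_inv : ∀ u : A.domain, R (A u - z • (u : H)) = u

/-- `Φ` is the bounded continuous functional calculus `F ↦ F(A)` on `[0,∞)` of `A`: a unital
`*`-homomorphism from the bounded continuous functions on `[0,∞)` to the bounded operators that
maps, for every `z ∈ ℂ ∖ [0,∞)`, the function `t ↦ (t - z)⁻¹` to the resolvent `(A - z)⁻¹`. -/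
def IsFunctionalCalculus (A : H →ₗ.[ℂ] H) (Φ : (ℝ≥0 →ᵇ ℂ) →⋆ₐ[ℂ] (H →L[ℂ] H)) : Prop :=
  ∀ (z : ℂ) (r : ℝ≥0 →ᵇ ℂ), (∀ t : ℝ≥0, (((t : ℝ) : ℂ) - z) * r t = 1) →
    IsResolventAt A z (Φ r)

end Unbounded

/-! ### The eigenfunctions and eigenvalues -/

/-- The Jacobi polynomial
`P_n^{(a,b)}(x) = (1/n!) ∑_k C(n,k) (n+a+b+1)_k (a+k+1)_{n-k} ((x-1)/2)^k`,
with `(y)_k = y (y+1) ⋯ (y+k-1)`. -/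
def jacobiP (n : ℕ) (a b x : ℝ) : ℝ :=
  (1 / (n.factorial : ℝ)) * ∑ k ∈ Finset.range (n + 1),
    (n.choose k : ℝ) * (ascPochhammer ℝ k).eval ((n : ℝ) + a + b + 1)
      * (ascPochhammer ℝ (n - k)).eval (a + k + 1) * ((x - 1) / 2) ^ k

/-- `c = (4 + (M²+λ)/κ)^{1/2}`. -/
def radialC (κ M lam : ℝ) : ℝ := Real.sqrt (4 + (M ^ 2 + lam) / κ)

/-- The eigenvalue `Ω_i = (2i+s+c+2)²`. -/
def radialEigenvalue (κ M : ℝ) (s : ℕ) (lam : ℝ) (i : ℕ) : ℝ :=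
  (2 * i + s + radialC κ M lam + 2) ^ 2

/-- The eigenfunction
`f_i(x) = N_i cos^s x sin^{2+c} x P_i^{(s+1,c)}(-cos 2x)` with
`N_i² = (2i+s+c+2) i! Γ(i+s+c+2) / ((i+s+1)! Γ(i+c+1))`. -/
def radialEigenfunction (κ M : ℝ) (s : ℕ) (lam : ℝ) (i : ℕ) (x : ℝ) : ℝ :=
  Real.sqrt ((2 * i + s + radialC κ M lam + 2) * i.factorial
      * Real.Gamma (i + s + radialC κ M lam + 2)
      / ((i + s + 1).factorial * Real.Gamma (i + radialC κ M lam + 1)))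
    * Real.cos x ^ s * Real.sin x ^ (2 + radialC κ M lam)
    * jacobiP i (s + 1) (radialC κ M lam) (-Real.cos (2 * x))

end

/-! A symmetric operator whose closure has an orthonormal basis of eigenvectors is essentially
self-adjoint, and its functional calculus is then forced to be diagonal in that basis. So everything
reduces to placing an explicit complete eigensystem in the domain of the closure.

Symmetry is Green's identity for test functions (`integral_radialExpr_symm`). For the eigensystem
put `p = 2 + c`, so that `p² - 4p = (M² + λ)/κ`. On the modes `cos^(s+2k) x sin^p x` the expression
`L(s,λ)` is two-term triangular: it yields `(s+2k+p)²` times the mode minus `4k(k+s+1)` times the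
mode with `k-1` (`radialMode_identity`). The Jacobi coefficients solve the resulting recurrence
(`jacobiCoeff_succ_mul`), so the Jacobi polynomials in `cos² x` diagonalise it with eigenvalues
`(2n+s+c+2)²`.

The analytic point is that each mode lies in the domain of the closure
(`radialModeL2_mem_closure_graph`). Multiplication by cutoffs gives test functions whose images
under `L(s,λ)` are bounded in `L²`. For `s = k = 0` the endpoint `π/2` is borderline and the
commutator terms need not tend to zero in norm; but boundedness suffices, because bounded sequences
that converge against a dense set converge weakly and a closed subspace is weakly closed
(`mk_mem_topologicalClosure_of_weak`).

Orthogonality follows from symmetry and distinct eigenvalues, the norms from a Beta integral and a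
partial fraction identity (`inner_jacobiPoly_self`), and completeness from Weierstrass approximation
in the variable `cos² x` (`topologicalClosure_eq_top_of_radialPoly_mem`). Finally, any functional
calculus acts on an eigenvector by the value at the eigenvalue
(`IsFunctionalCalculus.apply_eigenvector`), which gives uniqueness and the series at once. -/

/-! ### Diagonal operators, weak limits in graphs, and functional calculus in a Hilbert space. -/

section Abstract

open Filter Topology

variable {ι H : Type*} [NormedAddCommGroup H] [InnerProductSpace ℂ H]

namespace HilbertBasis

/-- The bounded operator that is diagonal in the Hilbert basis `b`, with entries `m i`. -/
noncomputable def diagonal (b : HilbertBasis ι ℂ H) (m : ι → ℂ) (C : ℝ) (hm : ∀ i, ‖m i‖ ≤ C) :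
    H →L[ℂ] H :=
  have hmem (x : H) : Memℓp (fun i => m i * b.repr x i) 2 :=
    ((lp.memℓp (b.repr x)).const_smul (C : ℂ)).mono' fun i => by
      simpa using mul_le_mul ((hm i).trans (le_abs_self C)) le_rfl (norm_nonneg _) (abs_nonneg C)
  LinearMap.mkContinuous
    { toFun x := b.repr.symm ⟨fun i => m i * b.repr x i, hmem x⟩
      map_add' x y := by
        rw [← map_add]
        congr 1
        ext i
        simp only [map_add, lp.coeFn_add, Pi.add_apply, mul_add]
      map_smul' a x := by
        rw [RingHom.id_apply, ← map_smul]
        congr 1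
        ext i
        -- The absolute value only matters for empty `ι`, where `hm` does not force `0 ≤ C`.
        simp [mul_left_comm] } |C| fun x => by
    change ‖b.repr.symm ⟨fun i => m i * b.repr x i, hmem x⟩‖ ≤ _
    rw [LinearIsometryEquiv.norm_map]
    refine lp.norm_le_of_forall_sum_le (by norm_num) (by positivity) fun t => ?_
    have hx := lp.sum_rpow_le_norm_rpow (by norm_num) (b.repr x) t
    rw [LinearIsometryEquiv.norm_map] at hx
    rw [Real.mul_rpow (abs_nonneg C) (norm_nonneg x)]
    refine le_trans ?_ (mul_le_mul_of_nonneg_left hx (by positivity))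
    rw [Finset.mul_sum]
    refine Finset.sum_le_sum fun i _ => ?_
    rw [norm_mul, Real.mul_rpow (norm_nonneg _) (norm_nonneg _)]
    gcongr
    exact (hm i).trans (le_abs_self C)

theorem inner_diagonal (b : HilbertBasis ι ℂ H) (m : ι → ℂ) (C : ℝ) (hm : ∀ i, ‖m i‖ ≤ C)
    (x : H) (i : ι) : inner ℂ (b i) (b.diagonal m C hm x) = m i * inner ℂ (b i) x := by
  rw [← b.repr_apply_apply, ← b.repr_apply_apply]
  change (b.repr (b.repr.symm _) : ι → ℂ) i = _
  rw [LinearIsometryEquiv.apply_symm_apply]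

theorem ext_inner (b : HilbertBasis ι ℂ H) {x y : H}
    (h : ∀ i, inner ℂ (b i) x = inner ℂ (b i) y) : x = y := by
  apply b.repr.injective
  ext i
  rw [b.repr_apply_apply, b.repr_apply_apply, h]

/-- The `*`-homomorphism `F ↦ F(A)` for the operator `A` that is diagonal in the Hilbert basis `b`
with eigenvalues `ω i`. -/
noncomputable def diagonalCalculus [CompleteSpace H] (b : HilbertBasis ι ℂ H) (ω : ι → ℝ≥0) :
    (ℝ≥0 →ᵇ ℂ) →⋆ₐ[ℂ] (H →L[ℂ] H) where
  toFun F := b.diagonal (fun i => F (ω i)) ‖F‖ fun i => F.norm_coe_le_norm (ω i)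
  map_one' := by
    ext x
    exact b.ext_inner fun i => by simp [inner_diagonal]
  map_mul' F G := by
    ext x
    exact b.ext_inner fun i => by simp [inner_diagonal, mul_assoc]
  map_zero' := by
    ext x
    exact b.ext_inner fun i => by simp [inner_diagonal]
  map_add' F G := by
    ext x
    exact b.ext_inner fun i => by simp [inner_diagonal, add_mul]
  commutes' a := by
    ext x
    exact b.ext_inner fun i => by simp [inner_diagonal, Algebra.algebraMap_eq_smul_one]
  map_star' F := by
    rw [ContinuousLinearMap.star_eq_adjoint, ContinuousLinearMap.eq_adjoint_iff]
    intro x y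
    rw [← b.tsum_inner_mul_inner, ← b.tsum_inner_mul_inner x]
    refine tsum_congr fun i => ?_
    rw [inner_diagonal, ← inner_conj_symm, inner_diagonal, map_mul, inner_conj_symm]
    simp only [BoundedContinuousFunction.star_apply, RCLike.star_def, RingHomCompTriple.comp_apply,
      RingHom.id_apply]
    ring

theorem inner_diagonalCalculus [CompleteSpace H] (b : HilbertBasis ι ℂ H) (ω : ι → ℝ≥0)
    (F : ℝ≥0 →ᵇ ℂ) (x : H) (i : ι) :
    inner ℂ (b i) (b.diagonalCalculus ω F x) = F (ω i) * inner ℂ (b i) x :=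
  b.inner_diagonal _ ‖F‖ (fun i => F.norm_coe_le_norm (ω i)) x i

/-- A closed subspace of `H × H` that contains all the pairs `(b i, ω i • b i)` contains the graph
of the diagonal operator with eigenvalues `ω i`. -/
theorem mk_mem_of_inner_eq_mul (b : HilbertBasis ι ℂ H) {ω : ι → ℂ} {G : Submodule ℂ (H × H)}
    (hG : IsClosed (G : Set (H × H))) (hb : ∀ i, (b i, ω i • b i) ∈ G) {u w : H}
    (h : ∀ i, inner ℂ (b i) w = ω i * inner ℂ (b i) u) : (u, w) ∈ G := by
  have h1 := (b.hasSum_repr u).prodMk (b.hasSum_repr w)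
  -- The partial sums of the two expansions are finite combinations of the pairs `(b i, ω i • b i)`.
  refine hG.mem_of_tendsto h1 (Eventually.of_forall fun t => G.sum_mem fun i _ => ?_)
  have h2 := G.smul_mem (b.repr u i) (hb i)
  rw [Prod.smul_mk, smul_smul, mul_comm] at h2
  rwa [b.repr_apply_apply w, h, ← b.repr_apply_apply]

end HilbertBasis

/-- A subspace of `H × H` contains in its closure the limits of bounded sequences of its elements
that converge weakly against a dense set. -/
theorem mk_mem_topologicalClosure_of_weak [CompleteSpace H] {G : Submodule ℂ (H × H)} {D : Set H}
    (hD : Dense D) {u y : ℕ → H} {u' y' : H} (hG : ∀ n, (u n, y n) ∈ G) {C : ℝ}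
    (hu : ∀ n, ‖u n‖ ≤ C) (hy : ∀ n, ‖y n‖ ≤ C)
    (hud : ∀ d ∈ D, ∀ᶠ n in atTop, inner ℂ d (u n) = inner ℂ d u')
    (hyd : ∀ d ∈ D, ∀ᶠ n in atTop, inner ℂ d (y n) = inner ℂ d y') :
    (u', y') ∈ G.topologicalClosure := by
  have weak : ∀ {v : ℕ → H} {v' : H}, (∀ n, ‖v n‖ ≤ C) →
      (∀ d ∈ D, ∀ᶠ n in atTop, inner ℂ d (v n) = inner ℂ d v') →
      ∀ z : H, Tendsto (fun n => inner ℂ z (v n)) atTop (𝓝 (inner ℂ z v')) := by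
    intro v v' hv hvd z
    rw [Metric.tendsto_atTop]
    intro ε hε
    have hC : 0 ≤ C := (norm_nonneg _).trans (hv 0)
    -- Eventually `v n - v'` is orthogonal to `d`, so only `z - d` contributes, and `‖v n - v'‖ ≤ C
    -- + ‖v'‖`.
    obtain ⟨d, hd, hzd⟩ := Metric.dense_iff.1 hD z (ε / (C + ‖v'‖ + 1)) (by positivity)
    rw [Metric.mem_ball, dist_comm, dist_eq_norm, lt_div_iff₀ (by positivity)] at hd
    obtain ⟨N, hN⟩ := eventually_atTop.1 (hvd d hzd)
    refine ⟨N, fun n hn => ?_⟩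
    have h1 : inner ℂ z (v n) - inner ℂ z v' = inner ℂ (z - d) (v n - v') := by
      rw [inner_sub_right, inner_sub_left, inner_sub_left, hN n hn]
      ring
    rw [dist_eq_norm, h1]
    calc ‖inner ℂ (z - d) (v n - v')‖ ≤ ‖z - d‖ * ‖v n - v'‖ := norm_inner_le_norm _ _
      _ ≤ ‖z - d‖ * (C + ‖v'‖ + 1) := by
        gcongr
        linarith [norm_sub_le (v n) v', hv n]
      _ < ε := hd
  -- The product `H × H` carries the sup norm; passing to the `ℓ²` product makes it a Hilbert space,
  -- where the closure of a subspace is its double orthogonal complement.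
  set e := WithLp.prodContinuousLinearEquiv 2 ℂ H H
  set K : Submodule ℂ (WithLp 2 (H × H)) := G.comap (e : WithLp 2 (H × H) →ₗ[ℂ] H × H)
  have hK : e.symm (u', y') ∈ Kᗮᗮ := by
    rw [Submodule.mem_orthogonal]
    intro p hp
    rw [Submodule.mem_orthogonal'] at hp
    have hlim : Tendsto (fun n => inner ℂ p.fst (u n) + inner ℂ p.snd (y n)) atTop
        (𝓝 (inner ℂ p.fst u' + inner ℂ p.snd y')) :=
      (weak hu hud p.fst).add (weak hy hyd p.snd)
    have hzero : ∀ n, inner ℂ p.fst (u n) + inner ℂ p.snd (y n) = 0 := fun n =>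
      hp (e.symm (u n, y n)) (hG n)
    simp only [hzero] at hlim
    exact tendsto_nhds_unique hlim tendsto_const_nhds
  rw [Submodule.orthogonal_orthogonal_eq_closure] at hK
  have := map_mem_closure e.continuous hK (t := (G : Set (H × H))) fun p hp => hp
  simpa [← SetLike.mem_coe, Submodule.topologicalClosure_coe] using this

theorem LinearPMap.exists_apply_eq_of_mem_graph {B : H →ₗ.[ℂ] H} {u w : H}
    (h : (u, w) ∈ B.graph) : ∃ hu : u ∈ B.domain, B ⟨u, hu⟩ = w := by
  obtain ⟨y, hy, hw⟩ := (LinearPMap.mem_graph_iff B).1 h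
  subst hy
  exact ⟨y.2, hw⟩

/-- Symmetric operators have orthogonal eigenvectors. -/
theorem LinearPMap.IsFormalAdjoint.inner_eq_zero {A : H →ₗ.[ℂ] H} (hA : A.IsFormalAdjoint A)
    {u v : H} {a c : ℝ}
    (hu : (u, (a : ℂ) • u) ∈ A.graph) (hv : (v, (c : ℂ) • v) ∈ A.graph) (hac : a ≠ c) :
    inner ℂ u v = 0 := by
  obtain ⟨hu', hu⟩ := LinearPMap.exists_apply_eq_of_mem_graph hu
  obtain ⟨hv', hv⟩ := LinearPMap.exists_apply_eq_of_mem_graph hv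
  have h := hA ⟨u, hu'⟩ ⟨v, hv'⟩
  rw [hu, hv, inner_smul_left, inner_smul_right, Complex.conj_ofReal] at h
  have h' : ((a : ℂ) - c) * inner ℂ u v = 0 := by rw [sub_mul, h, sub_self]
  refine (mul_eq_zero.1 h').resolve_left ?_
  exact sub_ne_zero.2 (by exact_mod_cast hac)

/-! ### Symmetric operators with a basis of eigenvectors. -/

variable [CompleteSpace H] {A : H →ₗ.[ℂ] H}

theorem LinearPMap.IsFormalAdjoint.isClosable (hA : A.IsFormalAdjoint A)
    (hd : Dense (A.domain : Set H)) : A.IsClosable :=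
  LinearPMap.isClosable_iff_exists_closed_extension.2
    ⟨A.adjoint, LinearPMap.adjoint_isClosed hd, LinearPMap.IsFormalAdjoint.le_adjoint hd hA⟩

/-- The closure is the least closed extension and adjoints are closed. Used once, this puts the
closure below `A.adjoint`, so the closure pairs symmetrically with `A`; used again, it puts the
closure below its own adjoint. -/
theorem LinearPMap.IsFormalAdjoint.closure (hA : A.IsFormalAdjoint A)
    (hd : Dense (A.domain : Set H)) : A.closure.IsFormalAdjoint A.closure := by
  have hcl := hA.isClosable hd
  have key : ∀ {S : H →ₗ.[ℂ] H}, S.IsClosed → A ≤ S → A.closure ≤ S := by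
    intro S hS hAS
    apply LinearPMap.le_of_le_graph
    rw [← hcl.graph_closure_eq_closure_graph]
    exact Submodule.topologicalClosure_minimal _ (LinearPMap.le_graph_of_le hAS) hS
  have h1 : A.closure ≤ A.adjoint :=
    key (LinearPMap.adjoint_isClosed hd) (LinearPMap.IsFormalAdjoint.le_adjoint hd hA)
  have hd' : Dense (A.closure.domain : Set H) := hd.mono A.le_closure.1
  have h2 : A.closure.IsFormalAdjoint A := fun x y => by
    rw [h1.2 (y := ⟨x, h1.1 x.2⟩) rfl]
    exact LinearPMap.adjoint_isFormalAdjoint hd ⟨x, h1.1 x.2⟩ y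
  have h3 : A.closure ≤ A.closure.adjoint :=
    key (LinearPMap.adjoint_isClosed hd') (LinearPMap.IsFormalAdjoint.le_adjoint hd' h2)
  intro x y
  rw [h3.2 (y := ⟨x, h3.1 x.2⟩) rfl]
  exact LinearPMap.adjoint_isFormalAdjoint hd' ⟨x, h3.1 x.2⟩ y

/-- A symmetric operator whose closure has an orthonormal basis of eigenvectors is essentially
self-adjoint. -/
theorem isEssentiallySelfAdjoint_of_hilbertBasis (hd : Dense (A.domain : Set H))
    (hA : A.IsFormalAdjoint A) (b : HilbertBasis ι ℂ H) (ω : ι → ℝ)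
    (hb : ∀ i, (b i, (ω i : ℂ) • b i) ∈ A.closure.graph) : IsEssentiallySelfAdjoint A where
  dense_domain := hd
  isClosable := hA.isClosable hd
  isSelfAdjoint_closure := by
    have hd' : Dense (A.closure.domain : Set H) := hd.mono A.le_closure.1
    refine le_antisymm (LinearPMap.le_of_le_graph fun p hp => ?_)
      (LinearPMap.IsFormalAdjoint.le_adjoint hd' (hA.closure hd))
    obtain ⟨u, w⟩ := p
    -- Pairing an element `(u, w)` of the graph of the adjoint with `b i` gives `⟪b i, w⟫ = ω i ⟪b
    -- i, u⟫`, so `(u, w)` already lies in the closed graph of `A.closure`.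
    refine b.mk_mem_of_inner_eq_mul (hA.isClosable hd).closure_isClosed hb fun i => ?_
    obtain ⟨hu, rfl⟩ := LinearPMap.exists_apply_eq_of_mem_graph hp
    obtain ⟨hi, hbi⟩ := LinearPMap.exists_apply_eq_of_mem_graph (hb i)
    have := (LinearPMap.adjoint_isFormalAdjoint hd').symm ⟨b i, hi⟩ ⟨u, hu⟩
    rw [hbi, inner_smul_left, Complex.conj_ofReal] at this
    exact this.symm

/-- Both resolvent identities are checked on coefficients, where they read `(ω i - z) r (ω i) = 1`.
Closedness of the graph puts the range of the resolvent in the domain; symmetry supplies the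
coefficients of `A.closure u`. -/
theorem isFunctionalCalculus_diagonalCalculus (hd : Dense (A.domain : Set H))
    (hA : A.IsFormalAdjoint A) (b : HilbertBasis ι ℂ H) (ω : ι → ℝ≥0)
    (hb : ∀ i, (b i, ((ω i : ℝ) : ℂ) • b i) ∈ A.closure.graph) :
    IsFunctionalCalculus A.closure (b.diagonalCalculus ω) := by
  intro z r hr
  refine ⟨fun v => ?_, fun u => b.ext_inner fun i => ?_⟩
  · have hmem : (b.diagonalCalculus ω r v, v + z • b.diagonalCalculus ω r v)
        ∈ A.closure.graph := by
      refine b.mk_mem_of_inner_eq_mul (hA.isClosable hd).closure_isClosed hb fun i => ?_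
      rw [inner_add_right, inner_smul_right, b.inner_diagonalCalculus]
      linear_combination (-inner ℂ (b i) v) * hr (ω i)
    obtain ⟨h, hv⟩ := LinearPMap.exists_apply_eq_of_mem_graph hmem
    exact ⟨h, by rw [hv, add_sub_cancel_right]⟩
  · obtain ⟨hi, hbi⟩ := LinearPMap.exists_apply_eq_of_mem_graph (hb i)
    have h := hA.closure hd ⟨b i, hi⟩ u
    rw [hbi, inner_smul_left, Complex.conj_ofReal] at h
    rw [b.inner_diagonalCalculus, inner_sub_right, inner_smul_right, ← h]
    linear_combination inner ℂ (b i) (u : H) * hr (ω i)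

/-! ### Uniqueness of the functional calculus. -/

/-- The resolvent function `t ↦ (t - z)⁻¹` on `[0,∞)`, for `z` off the real axis. -/
noncomputable def resolventFunction (z : ℂ) (hz : z.im ≠ 0) : ℝ≥0 →ᵇ ℂ :=
  have h0 (t : ℝ≥0) : ((t : ℝ) : ℂ) - z ≠ 0 := fun h => hz <| by
    have := congrArg Complex.im h
    simpa using this
  BoundedContinuousFunction.ofNormedAddCommGroup (fun t : ℝ≥0 => (((t : ℝ) : ℂ) - z)⁻¹)
    (((Complex.continuous_ofReal.comp NNReal.continuous_coe).sub continuous_const).inv₀ h0)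
    |z.im|⁻¹ fun t => by
      rw [norm_inv]
      refine inv_anti₀ (abs_pos.2 hz) ?_
      simpa using Complex.abs_im_le_norm (((t : ℝ) : ℂ) - z)

theorem resolventFunction_apply (z : ℂ) (hz : z.im ≠ 0) (t : ℝ≥0) :
    resolventFunction z hz t = (((t : ℝ) : ℂ) - z)⁻¹ := rfl

theorem sub_mul_resolventFunction (z : ℂ) (hz : z.im ≠ 0) (t : ℝ≥0) :
    (((t : ℝ) : ℂ) - z) * resolventFunction z hz t = 1 := by
  refine mul_inv_cancel₀ fun h => hz ?_
  have := congrArg Complex.im h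
  simpa using this

/-- A bounded continuous functional calculus acts on an eigenvector by the value of the function
at the eigenvalue. -/
theorem IsFunctionalCalculus.apply_eigenvector {Φ : (ℝ≥0 →ᵇ ℂ) →⋆ₐ[ℂ] (H →L[ℂ] H)}
    (hΦ : IsFunctionalCalculus A Φ) {v : H} {a : ℝ≥0} (hv : (v, ((a : ℝ) : ℂ) • v) ∈ A.graph)
    (F : ℝ≥0 →ᵇ ℂ) : Φ F v = F a • v := by
  obtain ⟨hv', hAv⟩ := LinearPMap.exists_apply_eq_of_mem_graph hv
  suffices h : ∀ G : ℝ≥0 →ᵇ ℂ, G a = 0 → Φ G v = 0 by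
    have h1 := h (F - algebraMap ℂ _ (F a)) (by simp [Algebra.algebraMap_eq_smul_one])
    rwa [map_sub, AlgHomClass.commutes, sub_apply, sub_eq_zero,
      Algebra.algebraMap_eq_smul_one, smul_apply,
      one_apply_eq_self] at h1
  intro G hG
  have key : ∀ δ > 0, ‖Φ G v‖ ≤ δ * ‖v‖ := by
    intro δ hδ
    obtain ⟨η, hη, hGη⟩ := Metric.continuousAt_iff.1 (G.continuous.continuousAt (x := a)) δ hδ
    -- The resolvent at `z = a + iε` acts on `v` as `(-iε)⁻¹`, so inserting `-iε • resolventFunction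
    -- z` leaves `Φ G v` unchanged. This factor has modulus `ε / |t - z|`, concentrated near `a`,
    -- where `G` is small; `ε` is chosen so that the product is at most `δ` everywhere.
    set ε : ℝ := δ * η / (‖G‖ + 1) with hε
    have hε0 : 0 < ε := by positivity
    set z : ℂ := (a : ℝ) + ε * Complex.I with hz
    have hz0 : z.im ≠ 0 := by simpa [hz] using hε0.ne'
    have hres := (hΦ z _ (sub_mul_resolventFunction z hz0)).left_inv ⟨v, hv'⟩
    rw [hAv, ← sub_smul, map_smul] at hres
    have hsub : ((a : ℝ) : ℂ) - z = -(ε * Complex.I) := by rw [hz]; ring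
    rw [hsub] at hres
    have h1 : Φ G v = Φ ((-(ε * Complex.I) : ℂ) • (G * resolventFunction z hz0)) v := by
      rw [map_smul, map_mul, smul_apply, mul_apply_eq_comp,
        ← map_smul, hres]
    rw [h1]
    refine (ContinuousLinearMap.le_opNorm _ _).trans ?_
    gcongr
    refine (NonUnitalStarAlgHom.norm_apply_le Φ _).trans ?_
    rw [BoundedContinuousFunction.norm_le hδ.le]
    intro t
    have hrt : ‖resolventFunction z hz0 t‖ = ‖((t : ℝ) : ℂ) - z‖⁻¹ := by
      rw [resolventFunction_apply, norm_inv]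
    have him : ε ≤ ‖((t : ℝ) : ℂ) - z‖ := by
      have := Complex.abs_im_le_norm (((t : ℝ) : ℂ) - z)
      simpa [hz, abs_of_pos hε0] using this
    have hre : |(t : ℝ) - a| ≤ ‖((t : ℝ) : ℂ) - z‖ := by
      have := Complex.abs_re_le_norm (((t : ℝ) : ℂ) - z)
      simpa [hz] using this
    have hpos : 0 < ‖((t : ℝ) : ℂ) - z‖ := hε0.trans_le him
    simp only [BoundedContinuousFunction.coe_smul, BoundedContinuousFunction.coe_mul,
      Pi.mul_apply, smul_eq_mul, norm_mul, norm_neg, Complex.norm_real, Complex.norm_I, mul_one,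
      hrt, Real.norm_eq_abs, abs_of_pos hε0]
    rw [← mul_assoc, ← div_eq_mul_inv, div_le_iff₀ hpos]
    -- Near `a`: `|G t| ≤ δ` and `ε ≤ |t - z|`. Away from `a`: `|t - z| ≥ η` and `ε ‖G‖ ≤ δ η`.
    by_cases ht : dist t a < η
    · have h2 := hGη ht
      rw [hG, dist_zero_right] at h2
      rw [mul_comm ε]
      exact mul_le_mul h2.le him hε0.le hδ.le
    · rw [not_lt, NNReal.dist_eq] at ht
      calc ε * ‖G t‖ ≤ ε * (‖G‖ + 1) := by
            gcongr
            linarith [G.norm_coe_le_norm t]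
        _ = δ * η := by rw [hε]; field_simp
        _ ≤ δ * ‖((t : ℝ) : ℂ) - z‖ := by gcongr; exact ht.trans hre
  by_contra hne
  have hne' : 0 < ‖Φ G v‖ := norm_pos_iff.2 hne
  have hv0 : 0 ≤ ‖v‖ := norm_nonneg v
  have h3 := key (‖Φ G v‖ / (2 * (‖v‖ + 1))) (by positivity)
  rw [div_mul_eq_mul_div, le_div_iff₀ (by positivity)] at h3
  nlinarith

theorem IsFunctionalCalculus.hasSum {Φ : (ℝ≥0 →ᵇ ℂ) →⋆ₐ[ℂ] (H →L[ℂ] H)}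
    (hΦ : IsFunctionalCalculus A Φ) (b : HilbertBasis ι ℂ H) (ω : ι → ℝ≥0)
    (hb : ∀ i, (b i, ((ω i : ℝ) : ℂ) • b i) ∈ A.graph) (F : ℝ≥0 →ᵇ ℂ) (x : H) :
    HasSum (fun i => (F (ω i) * inner ℂ (b i) x) • b i) (Φ F x) := by
  have h := (Φ F).hasSum (b.hasSum_repr x)
  refine h.congr_fun fun i => ?_
  rw [map_smul, hΦ.apply_eigenvector (hb i), b.repr_apply_apply, smul_smul, mul_comm]

/-- Existence is the diagonal calculus. Any other calculus has the same values on the eigenbasis,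
hence the same series by continuity of each operator. -/
theorem existsUnique_isFunctionalCalculus (hd : Dense (A.domain : Set H))
    (hA : A.IsFormalAdjoint A) (b : HilbertBasis ι ℂ H) (ω : ι → ℝ≥0)
    (hb : ∀ i, (b i, ((ω i : ℝ) : ℂ) • b i) ∈ A.closure.graph) :
    ∃! Φ : (ℝ≥0 →ᵇ ℂ) →⋆ₐ[ℂ] (H →L[ℂ] H), IsFunctionalCalculus A.closure Φ := by
  have hcalc := isFunctionalCalculus_diagonalCalculus hd hA b ω hb
  refine ⟨_, hcalc, fun Ψ hΨ => ?_⟩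
  ext F x
  exact (hΨ.hasSum b ω hb F x).unique (hcalc.hasSum b ω hb F x)

end Abstract

/-! ### The weighted `L²` space, density of test functions and symmetry. -/

section RadialSpace

open Filter Topology

theorem cos_pos_radial {x : ℝ} (hx : x ∈ Ioo 0 (Real.pi / 2)) : 0 < Real.cos x :=
  Real.cos_pos_of_mem_Ioo ⟨by linarith [hx.1, Real.pi_pos], hx.2⟩

theorem sin_pos_radial {x : ℝ} (hx : x ∈ Ioo 0 (Real.pi / 2)) : 0 < Real.sin x :=
  Real.sin_pos_of_pos_of_lt_pi hx.1 (by linarith [hx.2, Real.pi_pos])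

theorem aemeasurable_radialDensity :
    AEMeasurable (fun x => ENNReal.ofReal (2 * Real.cot x ^ 3))
      (volume.restrict (Ioo 0 (Real.pi / 2))) :=
  ((continuousOn_const.mul (continuousOn_cot_radial.pow 3)).aemeasurable
    measurableSet_Ioo).ennreal_ofReal

/-- The density is strictly positive on the interval, so both measures have the same null sets. -/
theorem ae_radial_iff {p : ℝ → Prop} :
    (∀ᵐ x ∂radialMeasure, p x) ↔ ∀ᵐ x ∂volume.restrict (Ioo 0 (Real.pi / 2)), p x := by
  rw [radialMeasure, ae_withDensity_iff' aemeasurable_radialDensity]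
  refine eventually_congr ?_
  filter_upwards [ae_restrict_mem measurableSet_Ioo] with x hx
  have := cot_pos_radial hx
  refine ⟨fun h => h ?_, fun h _ => h⟩
  rw [Ne, ENNReal.ofReal_eq_zero, not_le]
  positivity

theorem ae_radial_mem : ∀ᵐ x ∂radialMeasure, x ∈ Ioo 0 (Real.pi / 2) :=
  ae_radial_iff.2 (ae_restrict_mem measurableSet_Ioo)

theorem integral_radial {E : Type*} [NormedAddCommGroup E] [NormedSpace ℝ E] (g : ℝ → E) :
    ∫ x, g x ∂radialMeasure = ∫ x in Ioo 0 (Real.pi / 2), (2 * Real.cot x ^ 3) • g x := by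
  rw [radialMeasure, integral_withDensity_eq_integral_toReal_smul₀ aemeasurable_radialDensity
    (Eventually.of_forall fun _ => ENNReal.ofReal_lt_top)]
  refine setIntegral_congr_fun measurableSet_Ioo fun x hx => ?_
  have := cot_pos_radial hx
  rw [ENNReal.toReal_ofReal (by positivity)]

theorem integrable_radial_iff {E : Type*} [NormedAddCommGroup E] [NormedSpace ℝ E] {g : ℝ → E} :
    Integrable g radialMeasure ↔
      IntegrableOn (fun x => (2 * Real.cot x ^ 3) • g x) (Ioo 0 (Real.pi / 2)) := by
  rw [radialMeasure, integrable_withDensity_iff_integrable_smul₀' aemeasurable_radialDensity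
    (Eventually.of_forall fun _ => ENNReal.ofReal_lt_top)]
  refine integrableOn_congr_fun (fun x hx => ?_) measurableSet_Ioo
  have := cot_pos_radial hx
  rw [ENNReal.toReal_ofReal (by positivity)]

theorem ContinuousOn.aestronglyMeasurable_radial {g : ℝ → ℂ}
    (hg : ContinuousOn g (Ioo 0 (Real.pi / 2))) : AEStronglyMeasurable g radialMeasure :=
  (hg.aestronglyMeasurable measurableSet_Ioo).mono_ac (withDensity_absolutelyContinuous _ _)

theorem inner_toLp_radial {f g : ℝ → ℂ} (hf : MemLp f 2 radialMeasure)
    (hg : MemLp g 2 radialMeasure) :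
    inner ℂ (hf.toLp f) (hg.toLp g) = ∫ x, starRingEnd ℂ (f x) * g x ∂radialMeasure := by
  rw [L2.inner_def]
  refine integral_congr_ae ?_
  filter_upwards [hf.coeFn_toLp, hg.coeFn_toLp] with x hx hy
  rw [hx, hy, RCLike.inner_apply, mul_comm]

theorem norm_toLp_radial_sq {f : ℝ → ℂ} (hf : MemLp f 2 radialMeasure) :
    ‖hf.toLp f‖ ^ 2 = ∫ x, ‖f x‖ ^ 2 ∂radialMeasure := by
  have h := inner_toLp_radial hf hf
  have h' : ∀ x, starRingEnd ℂ (f x) * f x = ((‖f x‖ ^ 2 : ℝ) : ℂ) := fun x => by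
    rw [Complex.conj_mul']
    push_cast
    rfl
  simp only [h'] at h
  rw [integral_complex_ofReal, inner_self_eq_norm_sq_to_K] at h
  exact Complex.ofReal_injective (by simpa using h)

theorem radialMeasure_lt_top_of_isCompact {K : Set ℝ} (hK : IsCompact K)
    (hKI : K ⊆ Ioo 0 (Real.pi / 2)) : radialMeasure K < ⊤ := by
  rw [radialMeasure, withDensity_apply _ hK.measurableSet, Measure.restrict_restrict
    hK.measurableSet, inter_eq_left.2 hKI]
  exact ((continuousOn_const.mul ((continuousOn_cot_radial.mono hKI).pow 3)).integrableOn_compact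
    hK).lintegral_lt_top

theorem integrable_of_continuousOn_radial {E : Type*} [NormedAddCommGroup E] {g : ℝ → E}
    {K : Set ℝ} (hK : IsCompact K) (hKI : K ⊆ Ioo 0 (Real.pi / 2))
    (hg : ContinuousOn g (Ioo 0 (Real.pi / 2))) (h0 : ∀ x ∉ K, g x = 0) : Integrable g := by
  refine (integrableOn_iff_integrable_of_support_subset (s := K) fun x hx => ?_).1
    ((hg.mono hKI).integrableOn_compact hK)
  by_contra h
  exact hx (h0 x h)

/-- `L²(dν)` functions that are orthogonal to all test functions vanish. -/
theorem eq_zero_of_forall_inner_testToL2 {v : RadialL2}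
    (hv : ∀ φ : 𝓓(radialInterval, ℂ), inner ℂ (testToL2 φ) v = 0) : v = 0 := by
  have hloc : LocallyIntegrableOn v (Ioo 0 (Real.pi / 2)) radialMeasure := by
    rw [locallyIntegrableOn_iff isOpen_Ioo.isLocallyClosed]
    intro K hKI hK
    have : IsFiniteMeasure (radialMeasure.restrict K) :=
      ⟨by simpa using radialMeasure_lt_top_of_isCompact hK hKI⟩
    exact ((Lp.memLp v).restrict K).integrable (by norm_num)
  have h := isOpen_Ioo.ae_eq_zero_of_integral_contDiff_smul_eq_zero hloc fun g hg hgc hgU => ?_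
  · rw [Lp.eq_zero_iff_ae_eq_zero]
    filter_upwards [h, ae_radial_mem] with x hx hxI
    exact hx hxI
  · have hsupp : tsupport (fun x => (g x : ℂ)) ⊆ tsupport g :=
      closure_mono fun x hx h0 => hx (by simp [h0])
    let φ : 𝓓(radialInterval, ℂ) :=
      ⟨fun x => (g x : ℂ), Complex.ofRealCLM.contDiff.comp hg,
        hgc.comp_left (g := Complex.ofReal) Complex.ofReal_zero, hsupp.trans hgU⟩
    rw [← hv φ, L2.inner_def]
    refine integral_congr_ae ?_
    filter_upwards [(memLp_testFunction φ).coeFn_toLp] with x hx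
    change _ = inner ℂ ((memLp_testFunction φ).toLp φ x) (v x)
    rw [hx, RCLike.inner_apply, mul_comm]
    change _ = starRingEnd ℂ (g x : ℂ) * v x
    rw [Complex.conj_ofReal, Complex.real_smul]

theorem dense_range_testToL2 : Dense (LinearMap.range testToL2 : Set RadialL2) := by
  rw [Submodule.dense_iff_topologicalClosure_eq_top, Submodule.topologicalClosure_eq_top_iff,
    Submodule.eq_bot_iff]
  intro v hv
  exact eq_zero_of_forall_inner_testToL2 fun φ =>
    (Submodule.mem_orthogonal _ _).1 hv _ (LinearMap.mem_range_self _ φ)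

theorem dense_domain_radialOp (κ M : ℝ) (s : ℕ) (lam : ℝ) :
    Dense ((radialOp κ M s lam).domain : Set RadialL2) :=
  dense_range_testToL2

/-- With `w = 2 cot³` this is `w' = -3 (tan + cot) w`, which puts `L(s,λ)` in the Sturm–Liouville
form `-w⁻¹ (w f')' + V f`. -/
theorem hasDerivAt_radialWeight {x : ℝ} (hx : x ∈ Ioo 0 (Real.pi / 2)) :
    HasDerivAt (fun y => 2 * Real.cot y ^ 3)
      (-(3 * (Real.tan x + Real.cot x)) * (2 * Real.cot x ^ 3)) x := by
  have hs := (sin_pos_radial hx).ne'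
  have hc := (cos_pos_radial hx).ne'
  have h : HasDerivAt (fun y => Real.cos y / Real.sin y)
      ((-Real.sin x * Real.sin x - Real.cos x * Real.cos x) / Real.sin x ^ 2) x :=
    (Real.hasDerivAt_cos x).div (Real.hasDerivAt_sin x) hs
  simp only [Real.cot_eq_cos_div_sin, Real.tan_eq_sin_div_cos]
  refine ((h.pow 3).const_mul 2).congr_deriv ?_
  simp only [Nat.cast_ofNat, Nat.add_one_sub_one]
  field_simp
  ring

theorem hasDerivAt_testFunction (φ : 𝓓(radialInterval, ℂ)) (x : ℝ) :
    HasDerivAt φ (deriv φ x) x ∧ HasDerivAt (deriv φ) (deriv (deriv φ) x) x := by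
  have h := contDiff_testFunction φ
  have h1 := h
  rw [show (2 : WithTop ℕ∞) = 1 + 1 by norm_num, contDiff_succ_iff_deriv] at h1
  exact ⟨(h.differentiable (by norm_num) x).hasDerivAt,
    (h1.2.2.differentiable (by norm_num) x).hasDerivAt⟩

/-- Green's identity: the weighted difference of the integrands is the derivative of the Wronskian
`W = w (φ̄ ψ' - φ̄' ψ)`. The potential cancels because it is real, and `W` has compact support in
the interval. -/
theorem integral_radialExpr_symm (κ M : ℝ) (s : ℕ) (lam : ℝ) (φ ψ : 𝓓(radialInterval, ℂ)) :
    ∫ x, starRingEnd ℂ (radialExpr κ M s lam φ x) * ψ x ∂radialMeasure =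
      ∫ x, starRingEnd ℂ (φ x) * radialExpr κ M s lam ψ x ∂radialMeasure := by
  have int_mul : ∀ {f g : ℝ → ℂ}, MemLp f 2 radialMeasure → MemLp g 2 radialMeasure →
      Integrable (fun x => starRingEnd ℂ (f x) * g x) radialMeasure := fun hf hg =>
    hf.star.integrable_mul hg
  have i1 := int_mul (memLp_radialExpr κ M s lam φ) (memLp_testFunction ψ)
  have i2 := int_mul (memLp_testFunction φ) (memLp_radialExpr κ M s lam ψ)
  rw [← sub_eq_zero, ← integral_sub i1 i2, integral_radial]
  have i3 := integrable_radial_iff.1 (i1.sub i2)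
  set W : ℝ → ℂ := fun x => ((2 * Real.cot x ^ 3 : ℝ) : ℂ) *
    (starRingEnd ℂ (φ x) * deriv ψ x - starRingEnd ℂ (deriv φ x) * ψ x) with hW
  have hW0 : ∀ x ∉ tsupport φ, W x = 0 := fun x hx => by
    have h1 : deriv φ x = 0 :=
      image_eq_zero_of_notMem_tsupport fun h => hx (tsupport_deriv_subset h)
    simp [hW, image_eq_zero_of_notMem_tsupport hx, h1]
  have hder : ∀ x ∈ Ioo 0 (Real.pi / 2), HasDerivAt W ((2 * Real.cot x ^ 3 : ℝ) •
      (starRingEnd ℂ (radialExpr κ M s lam φ x) * ψ x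
        - starRingEnd ℂ (φ x) * radialExpr κ M s lam ψ x)) x := by
    intro x hx
    obtain ⟨a1, a2⟩ := hasDerivAt_testFunction φ x
    obtain ⟨b1, b2⟩ := hasDerivAt_testFunction ψ x
    refine ((hasDerivAt_radialWeight hx).ofReal_comp.mul
      ((a1.star.mul b2).sub (a2.star.mul b1))).congr_deriv ?_
    simp only [radialExpr, map_add, map_mul, map_neg, Complex.conj_ofReal, Complex.real_smul,
      ← starRingEnd_apply, Complex.ofReal_mul, Complex.ofReal_neg, Pi.mul_apply, Pi.sub_apply]
    ring
  -- Off the interval `cot` may be singular, but `W` vanishes identically near such points, so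
  -- integration over the whole line is possible.
  have hW0' : ∀ x ∉ Ioo 0 (Real.pi / 2), HasDerivAt W 0 x := fun x hx => by
    refine (hasDerivAt_const x (0 : ℂ)).congr_of_eventuallyEq ?_
    filter_upwards [(isClosed_tsupport φ).isOpen_compl.mem_nhds
      fun h => hx (φ.tsupport_subset h)] with y hy using hW0 y hy
  have hder' : ∀ x, HasDerivAt W ((Ioo 0 (Real.pi / 2)).indicator (fun x => (2 * Real.cot x ^ 3) •
      (starRingEnd ℂ (radialExpr κ M s lam φ x) * ψ x
        - starRingEnd ℂ (φ x) * radialExpr κ M s lam ψ x)) x) x := by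
    intro x
    by_cases hx : x ∈ Ioo 0 (Real.pi / 2)
    · rw [indicator_of_mem hx]
      exact hder x hx
    · rw [indicator_of_notMem hx]
      exact hW0' x hx
  rw [← integral_indicator measurableSet_Ioo]
  refine integral_eq_zero_of_hasDerivAt_of_integrable hder' (i3.integrable_indicator
    measurableSet_Ioo) (integrable_of_continuousOn_radial φ.hasCompactSupport φ.tsupport_subset
      (fun x hx => (hder x hx).continuousAt.continuousWithinAt) hW0)

theorem isFormalAdjoint_radialOp (κ M : ℝ) (s : ℕ) (lam : ℝ) :
    (radialOp κ M s lam).IsFormalAdjoint (radialOp κ M s lam) := by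
  rintro ⟨_, φ, rfl⟩ ⟨_, ψ, rfl⟩
  rw [radialOp_apply, radialOp_apply]
  change inner ℂ _ ((memLp_testFunction ψ).toLp ψ) = inner ℂ ((memLp_testFunction φ).toLp φ) _
  rw [inner_toLp_radial, inner_toLp_radial, integral_radialExpr_symm]

end RadialSpace

/-! ### Action of the differential expression on the modes `cos^σ x sin^p x`. -/

section RadialMode

open Filter Topology

/-- The function `cos^σ x sin^p x`. -/
noncomputable def radialMode (σ : ℕ) (p x : ℝ) : ℝ := Real.cos x ^ σ * Real.sin x ^ p

/-- The second derivative of `h` on `(0, π/2)` determines `L(s,λ) h` for real-valued `h`. -/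
theorem radialExpr_ofReal (κ M : ℝ) (s : ℕ) (lam : ℝ) {h h₁ : ℝ → ℝ} {h₂ x : ℝ}
    (hx : x ∈ Ioo 0 (Real.pi / 2)) (d₁ : ∀ y ∈ Ioo 0 (Real.pi / 2), HasDerivAt h (h₁ y) y)
    (d₂ : HasDerivAt h₁ h₂ x) :
    radialExpr κ M s lam (fun y => (h y : ℂ)) x =
      ((-h₂ + 3 * (Real.tan x + Real.cot x) * h₁ x + radialPotential κ M s lam x * h x : ℝ) : ℂ)
      := by
  have e₁ : ∀ y ∈ Ioo 0 (Real.pi / 2), deriv (fun y => (h y : ℂ)) y = (h₁ y : ℂ) := fun y hy =>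
    (d₁ y hy).ofReal_comp.deriv
  have e₂ : deriv (deriv fun y => (h y : ℂ)) x = (h₂ : ℂ) := by
    rw [← d₂.ofReal_comp.deriv]
    refine EventuallyEq.deriv_eq ?_
    filter_upwards [isOpen_Ioo.mem_nhds hx] with y hy using e₁ y hy
  rw [radialExpr, e₂, e₁ x hx]
  push_cast
  ring

theorem hasDerivAt_radialMode (σ : ℕ) (p : ℝ) {x : ℝ} (hx : x ∈ Ioo 0 (Real.pi / 2)) :
    HasDerivAt (radialMode σ p)
      ((p * Real.cot x - σ * Real.tan x) * radialMode σ p x) x := by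
  have hs := sin_pos_radial hx
  have hc := cos_pos_radial hx
  have h := ((Real.hasDerivAt_cos x).pow σ).mul
    ((Real.hasDerivAt_sin x).rpow_const (p := p) (Or.inl hs.ne'))
  refine h.congr_deriv ?_
  rw [radialMode, Real.rpow_sub_one hs.ne', Real.cot_eq_cos_div_sin, Real.tan_eq_sin_div_cos]
  rcases σ with _ | σ
  · simp
    field_simp
  · simp only [Nat.add_sub_cancel, Pi.pow_apply, pow_succ]
    field_simp
    ring

theorem hasDerivAt_deriv_radialMode (σ : ℕ) (p : ℝ) {x : ℝ} (hx : x ∈ Ioo 0 (Real.pi / 2)) :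
    HasDerivAt (fun y => (p * Real.cot y - σ * Real.tan y) * radialMode σ p y)
      ((-p / Real.sin x ^ 2 - σ / Real.cos x ^ 2 + (p * Real.cot x - σ * Real.tan x) ^ 2)
        * radialMode σ p x) x := by
  have hs := sin_pos_radial hx
  have hc := cos_pos_radial hx
  have h1 : HasDerivAt Real.cot (-1 / Real.sin x ^ 2) x := by
    have h : HasDerivAt (fun y => Real.cos y / Real.sin y)
        ((-Real.sin x * Real.sin x - Real.cos x * Real.cos x) / Real.sin x ^ 2) x :=
      (Real.hasDerivAt_cos x).div (Real.hasDerivAt_sin x) hs.ne'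
    refine (h.congr_of_eventuallyEq (Eventually.of_forall Real.cot_eq_cos_div_sin)).congr_deriv ?_
    congr 1
    linarith [Real.sin_sq_add_cos_sq x]
  refine (((h1.const_mul p).sub ((Real.hasDerivAt_tan hc.ne').const_mul (σ : ℝ))).mul
    (hasDerivAt_radialMode σ p hx)).congr_deriv ?_
  simp only [Pi.sub_apply]
  ring

/-- The image of `cos^(s+2k) x sin^p x` under `L(s,λ)`, where `p² - 4p = (M²+λ)/κ`. -/
noncomputable def radialModeImage (s k : ℕ) (p x : ℝ) : ℝ :=
  (s + 2 * k + p) ^ 2 * radialMode (s + 2 * k) p x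
    - 4 * k * (k + s + 1) * radialMode (s + 2 * (k - 1)) p x

/-- The relation `hp` is the indicial equation at `0`; it removes the `sin⁻²` singularity. The
`cos⁻²` terms leave `(s+2k)(s+2k+2) - s(s+2) = 4k(k+s+1)`, and dividing by `cos²` lowers `k` by one.
-/
theorem radialMode_identity {κ M : ℝ} {lam p : ℝ} (s k : ℕ)
    (hp : p ^ 2 - 4 * p = (M ^ 2 + lam) / κ) {x : ℝ} (hx : x ∈ Ioo 0 (Real.pi / 2)) :
    (-(-p / Real.sin x ^ 2 - (s + 2 * k : ℕ) / Real.cos x ^ 2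
        + (p * Real.cot x - (s + 2 * k : ℕ) * Real.tan x) ^ 2)
      + 3 * (Real.tan x + Real.cot x) * (p * Real.cot x - (s + 2 * k : ℕ) * Real.tan x)
      + radialPotential κ M s lam x) * radialMode (s + 2 * k) p x = radialModeImage s k p x := by
  have hs := sin_pos_radial hx
  have hc := cos_pos_radial hx
  have h1 : 4 * k * (k + s + 1) * radialMode (s + 2 * (k - 1)) p x
      = 4 * k * (k + s + 1) / Real.cos x ^ 2 * radialMode (s + 2 * k) p x := by
    -- For `k = 0` the truncated exponent `k - 1` is harmless, since its coefficient vanishes.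
    rcases k with _ | k
    · simp
    · rw [radialMode, radialMode, Nat.add_sub_cancel, mul_add 2 k 1, ← add_assoc s, pow_add]
      field_simp
      ring
  have h2 : (M ^ 2 + lam) / (κ * Real.sin x ^ 2) = (p ^ 2 - 4 * p) / Real.sin x ^ 2 := by
    rw [hp, div_div]
  rw [radialModeImage, h1, ← sub_mul, radialPotential, h2, Real.cot_eq_cos_div_sin,
    Real.tan_eq_sin_div_cos]
  congr 1
  have h3 := Real.sin_sq_add_cos_sq x
  push_cast
  field_simp
  set a := Real.sin x
  set b := Real.cos x
  linear_combination (-(p * b ^ 2 + (s + 2 * k) * a ^ 2 + (p ^ 2 - 4 * p) * b ^ 2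
    + (s + 2 * k) * (s + 2 * k + 2) * a ^ 2)) * h3

end RadialMode

/-! ### Smooth cutoffs at both endpoints. -/

section Cutoff

open Filter Topology

theorem smoothTransition_bounds : ∃ C : ℝ, 0 ≤ C ∧ ∀ y,
    |deriv Real.smoothTransition y| ≤ C ∧ |deriv (deriv Real.smoothTransition) y| ≤ C ∧
    (y ∉ Icc (0 : ℝ) 1 → deriv Real.smoothTransition y = 0 ∧
      deriv (deriv Real.smoothTransition) y = 0) := by
  have hS : ContDiff ℝ 2 Real.smoothTransition := Real.smoothTransition.contDiff (n := 2)
  have hS1 : ContDiff ℝ 1 (deriv Real.smoothTransition) := by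
    rw [show (2 : WithTop ℕ∞) = 1 + 1 by norm_num, contDiff_succ_iff_deriv] at hS
    exact hS.2.2
  have h0 : ∀ y ∉ Icc (0 : ℝ) 1, deriv Real.smoothTransition y = 0 := by
    intro y hy
    rw [mem_Icc, not_and_or, not_le, not_le] at hy
    rcases hy with hy | hy
    · have : Real.smoothTransition =ᶠ[𝓝 y] fun _ => 0 := by
        filter_upwards [Iio_mem_nhds hy] with z hz
        exact Real.smoothTransition.zero_of_nonpos (le_of_lt hz)
      rw [this.deriv_eq, deriv_const]
    · have : Real.smoothTransition =ᶠ[𝓝 y] fun _ => 1 := by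
        filter_upwards [Ioi_mem_nhds hy] with z hz
        exact Real.smoothTransition.one_of_one_le (le_of_lt hz)
      rw [this.deriv_eq, deriv_const]
  have h1 : ∀ y ∉ Icc (0 : ℝ) 1, deriv (deriv Real.smoothTransition) y = 0 := by
    intro y hy
    have : deriv Real.smoothTransition =ᶠ[𝓝 y] fun _ => 0 := by
      filter_upwards [isClosed_Icc.isOpen_compl.mem_nhds hy] with z hz using h0 z hz
    rw [this.deriv_eq, deriv_const]
  obtain ⟨C₁, hC₁⟩ := isCompact_Icc.exists_bound_of_continuousOn (s := Icc (0 : ℝ) 1)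
    hS1.continuous.continuousOn
  obtain ⟨C₂, hC₂⟩ := isCompact_Icc.exists_bound_of_continuousOn (s := Icc (0 : ℝ) 1)
    (hS1.continuous_deriv le_rfl).continuousOn
  refine ⟨max 0 (max C₁ C₂), le_max_left _ _, fun y => ?_⟩
  by_cases hy : y ∈ Icc (0 : ℝ) 1
  · exact ⟨(hC₁ y hy).trans ((le_max_left _ _).trans (le_max_right _ _)),
      (hC₂ y hy).trans ((le_max_right _ _).trans (le_max_right _ _)), fun h => (h hy).elim⟩
  · rw [h0 y hy, h1 y hy, abs_zero]
    exact ⟨le_max_left _ _, le_max_left _ _, fun _ => ⟨rfl, rfl⟩⟩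

/-- A smooth cutoff function that vanishes where `x (π/2 - x) ≤ 1/(n+1)` and equals one where
`x (π/2 - x) ≥ 2/(n+1)`. -/
noncomputable def radialCutoff (n : ℕ) (x : ℝ) : ℝ :=
  Real.smoothTransition ((n + 1) * (x * (Real.pi / 2 - x)) - 1)

theorem contDiff_radialCutoff (n : ℕ) : ContDiff ℝ (⊤ : ℕ∞) (radialCutoff n) :=
  Real.smoothTransition.contDiff.comp (by fun_prop)

theorem radialCutoff_eq_zero {n : ℕ} {x : ℝ} (hx : (n + 1) * (x * (Real.pi / 2 - x)) ≤ 1) :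
    radialCutoff n x = 0 :=
  Real.smoothTransition.zero_of_nonpos (by linarith)

theorem radialCutoff_eq_one {n : ℕ} {x : ℝ} (hx : 2 ≤ (n + 1) * (x * (Real.pi / 2 - x))) :
    radialCutoff n x = 1 :=
  Real.smoothTransition.one_of_one_le (by linarith)

theorem radialCutoff_mem_Icc (n : ℕ) (x : ℝ) : radialCutoff n x ∈ Icc 0 1 :=
  ⟨Real.smoothTransition.nonneg _, Real.smoothTransition.le_one _⟩

theorem mul_sub_pos_radial_iff {x : ℝ} :
    0 < x * (Real.pi / 2 - x) ↔ x ∈ Ioo 0 (Real.pi / 2) := by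
  refine ⟨fun h => ?_, fun h => mul_pos h.1 (sub_pos.2 h.2)⟩
  rcases mul_pos_iff.1 h with h | h
  · exact ⟨h.1, by linarith⟩
  · linarith [Real.pi_pos]

/-- The first two derivatives of the cutoff functions, with uniform bounds. -/
theorem exists_radialCutoff_derivs : ∃ C : ℝ, 0 ≤ C ∧ ∀ n : ℕ, ∃ χ₁ χ₂ : ℝ → ℝ,
    (∀ x, HasDerivAt (radialCutoff n) (χ₁ x) x) ∧ (∀ x, HasDerivAt χ₁ (χ₂ x) x) ∧
    ∀ x ∈ Ioo 0 (Real.pi / 2), |χ₁ x| * (x * (Real.pi / 2 - x)) ≤ C ∧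
      |χ₂ x| * (x * (Real.pi / 2 - x)) ^ 2 ≤ C ∧
      ((n + 1) * (x * (Real.pi / 2 - x)) ∉ Icc (1 : ℝ) 2 → χ₁ x = 0 ∧ χ₂ x = 0) := by
  obtain ⟨C, hC, hS⟩ := smoothTransition_bounds
  -- Where the derivatives are nonzero, `(n+1) w ≤ 2` for `w = x (π/2 - x)`, with `|w'| ≤ 2`, `|w''|
  -- = 2` and `w ≤ 1`. The chain rule then gives `4C` for the first bound and `16C + 4C` for the
  -- second.
  refine ⟨20 * C, by positivity, fun n => ?_⟩
  have hS2 : ContDiff ℝ 2 Real.smoothTransition := Real.smoothTransition.contDiff (n := 2)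
  have hd1 : ∀ y, HasDerivAt Real.smoothTransition (deriv Real.smoothTransition y) y := fun y =>
    (hS2.differentiable (by norm_num) y).hasDerivAt
  have hd2 : ∀ y, HasDerivAt (deriv Real.smoothTransition)
      (deriv (deriv Real.smoothTransition) y) y := by
    rw [show (2 : WithTop ℕ∞) = 1 + 1 by norm_num, contDiff_succ_iff_deriv] at hS2
    exact fun y => (hS2.2.2.differentiable (by norm_num) y).hasDerivAt
  set y : ℝ → ℝ := fun x => (n + 1) * (x * (Real.pi / 2 - x)) - 1 with hy
  have hyd : ∀ x, HasDerivAt y ((n + 1) * (Real.pi / 2 - 2 * x)) x := fun x => by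
    refine ((((hasDerivAt_id x).mul ((hasDerivAt_id x).const_sub (Real.pi / 2))).const_mul
      ((n : ℝ) + 1)).sub_const 1).congr_deriv ?_
    simp only [id]
    ring
  have hyd2 : ∀ x, HasDerivAt (fun x : ℝ => ((n : ℝ) + 1) * (Real.pi / 2 - 2 * x))
      (-2 * ((n : ℝ) + 1)) x := fun x => by
    refine ((((hasDerivAt_id x).const_mul (2 : ℝ)).const_sub (Real.pi / 2)).const_mul
      ((n : ℝ) + 1)).congr_deriv ?_
    ring
  refine ⟨fun x => deriv Real.smoothTransition (y x) * ((n + 1) * (Real.pi / 2 - 2 * x)),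
    fun x => deriv (deriv Real.smoothTransition) (y x) * ((n + 1) * (Real.pi / 2 - 2 * x))
      * ((n + 1) * (Real.pi / 2 - 2 * x)) + deriv Real.smoothTransition (y x) *
      (-2 * ((n : ℝ) + 1)), fun x => (hd1 (y x)).comp x (hyd x),
    fun x => ((hd2 (y x)).comp x (hyd x)).mul (hyd2 x), fun x hx => ?_⟩
  have hw := mul_sub_pos_radial_iff.2 hx
  set w := x * (Real.pi / 2 - x) with hw'
  obtain ⟨b1, b2, b3⟩ := hS (y x)
  have hyw : y x = (n + 1) * w - 1 := rfl
  have hn : (0 : ℝ) < n + 1 := by positivity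
  by_cases hnw : ((n : ℝ) + 1) * w ∈ Icc (1 : ℝ) 2
  · have hpi : |Real.pi / 2 - 2 * x| ≤ 2 := by
      rw [abs_le]
      constructor <;> linarith [hx.1, hx.2, Real.pi_le_four, Real.pi_pos]
    have hw1 : w ≤ 1 := by
      have := Real.pi_le_four
      have : Real.pi ^ 2 ≤ 4 ^ 2 := by gcongr
      nlinarith [sq_nonneg (Real.pi / 4 - x)]
    refine ⟨?_, ?_, fun h => (h hnw).elim⟩
    · rw [abs_mul, abs_mul, abs_of_pos hn]
      calc |deriv Real.smoothTransition (y x)| * ((n + 1) * |Real.pi / 2 - 2 * x|) * w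
          = |deriv Real.smoothTransition (y x)| * |Real.pi / 2 - 2 * x| * ((n + 1) * w) := by ring
        _ ≤ C * 2 * 2 := by
          gcongr
          exact hnw.2
        _ ≤ 20 * C := by linarith
    · calc _ ≤ (|deriv (deriv Real.smoothTransition) (y x)| * ((n + 1) * |Real.pi / 2 - 2 * x|)
            * ((n + 1) * |Real.pi / 2 - 2 * x|)
            + |deriv Real.smoothTransition (y x)| * (2 * (n + 1))) * w ^ 2 := by
            refine mul_le_mul_of_nonneg_right ((abs_add_le _ _).trans_eq ?_) (by positivity)
            simp only [abs_mul, abs_neg, abs_of_pos hn, abs_two]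
        _ = |deriv (deriv Real.smoothTransition) (y x)| * |Real.pi / 2 - 2 * x| ^ 2
            * ((n + 1) * w) ^ 2
            + |deriv Real.smoothTransition (y x)| * 2 * ((n + 1) * w) * w := by ring
        _ ≤ C * 2 ^ 2 * 2 ^ 2 + C * 2 * 2 * 1 := by
          gcongr
          exacts [hnw.2, hnw.2]
        _ = 20 * C := by ring
  · have h0 := b3 fun h => hnw <| by
      rw [hyw] at h
      exact ⟨by linarith [h.1], by linarith [h.2]⟩
    simp only [h0.1, h0.2, zero_mul, add_zero, abs_zero]
    exact ⟨by positivity, by positivity, fun _ => ⟨trivial, trivial⟩⟩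

theorem contDiffAt_radialMode (σ : ℕ) (p : ℝ) {x : ℝ} (hx : x ∈ Ioo 0 (Real.pi / 2)) :
    ContDiffAt ℝ (⊤ : ℕ∞) (radialMode σ p) x :=
  (Real.contDiff_cos.contDiffAt.pow σ).mul
    (Real.contDiff_sin.contDiffAt.rpow_const_of_ne (sin_pos_radial hx).ne')

/-- The cut off function `cos^σ x sin^p x` as a test function. -/
noncomputable def cutoffMode (n σ : ℕ) (p : ℝ) : 𝓓(radialInterval, ℂ) :=
  have hcl : IsClosed {x : ℝ | 1 ≤ (n + 1) * (x * (Real.pi / 2 - x))} :=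
    isClosed_le continuous_const (by fun_prop)
  have hsub : {x : ℝ | 1 ≤ (n + 1) * (x * (Real.pi / 2 - x))} ⊆ Ioo 0 (Real.pi / 2) :=
    fun x (hx : 1 ≤ (n + 1) * (x * (Real.pi / 2 - x))) => mul_sub_pos_radial_iff.1
      (pos_of_mul_pos_right (zero_lt_one.trans_le hx) (by positivity))
  have hsupp : tsupport (fun x => ((radialCutoff n x * radialMode σ p x : ℝ) : ℂ)) ⊆
      {x : ℝ | 1 ≤ (n + 1) * (x * (Real.pi / 2 - x))} :=
    closure_minimal (fun x hx => by
      by_contra h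
      exact hx (by simp [radialCutoff_eq_zero (not_le.1 h).le])) hcl
  { toFun := fun x => ((radialCutoff n x * radialMode σ p x : ℝ) : ℂ)
    contDiff' := by
      rw [contDiff_iff_contDiffAt]
      intro x
      by_cases hx : x ∈ Ioo 0 (Real.pi / 2)
      · exact Complex.ofRealCLM.contDiff.contDiffAt.comp x
          ((contDiff_radialCutoff n).contDiffAt.mul (contDiffAt_radialMode σ p hx))
      · refine contDiffAt_const (c := (0 : ℂ)) |>.congr_of_eventuallyEq ?_
        have hx' := fun h => hx (hsub (hsupp h))
        filter_upwards [(isClosed_tsupport _).isOpen_compl.mem_nhds hx'] with y hy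
          using image_eq_zero_of_notMem_tsupport
            (f := fun x => ((radialCutoff n x * radialMode σ p x : ℝ) : ℂ)) hy
    hasCompactSupport' := by
      refine IsCompact.of_isClosed_subset (isCompact_Icc (a := (0 : ℝ)) (b := Real.pi / 2))
        (isClosed_tsupport _) (hsupp.trans (hsub.trans Ioo_subset_Icc_self))
    tsupport_subset' := hsupp.trans hsub }

theorem cutoffMode_apply (n σ : ℕ) (p x : ℝ) :
    cutoffMode n σ p x = ((radialCutoff n x * radialMode σ p x : ℝ) : ℂ) := rfl

end Cutoff

/-! ### The modes lie in the domain of the closure. -/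

section ModeInClosure

open Filter Topology

theorem continuousOn_radialMode (σ : ℕ) (p : ℝ) :
    ContinuousOn (radialMode σ p) (Ioo 0 (Real.pi / 2)) := fun _ hx =>
  (contDiffAt_radialMode σ p hx).continuousAt.continuousWithinAt

/-- Only `sin^p ≤ sin³` and `cos^σ ≤ 1` are used, which leaves `2 (sin x cos x)³`. The cubic decay
at both endpoints is exactly what the commutator estimate consumes. -/
theorem weight_mul_radialMode_sq_le (σ : ℕ) {p : ℝ} (hp : 3 ≤ p) {x : ℝ}
    (hx : x ∈ Ioo 0 (Real.pi / 2)) :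
    2 * Real.cot x ^ 3 * radialMode σ p x ^ 2 ≤ 2 * (x * (Real.pi / 2 - x)) ^ 3 := by
  have hs := sin_pos_radial hx
  have hc := cos_pos_radial hx
  have h1 : Real.sin x ^ p ≤ Real.sin x ^ 3 := by
    have := Real.rpow_le_rpow_of_exponent_ge hs (Real.sin_le_one x) hp
    rwa [show (3 : ℝ) = ((3 : ℕ) : ℝ) by norm_num, Real.rpow_natCast] at this
  have h2 : Real.cos x ^ σ ≤ 1 := pow_le_one₀ hc.le (Real.cos_le_one x)
  have h3 : radialMode σ p x ≤ Real.sin x ^ 3 := by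
    rw [radialMode, ← one_mul (Real.sin x ^ 3)]
    gcongr
  have h4 : 0 ≤ radialMode σ p x := mul_nonneg (by positivity) (by positivity)
  have h5 : Real.sin x ≤ x := (Real.sin_lt hx.1).le
  have h6 : Real.cos x ≤ Real.pi / 2 - x := by
    rw [← Real.sin_pi_div_two_sub]
    exact (Real.sin_lt (sub_pos.2 hx.2)).le
  have h7 : 0 < Real.cot x := cot_pos_radial hx
  calc 2 * Real.cot x ^ 3 * radialMode σ p x ^ 2
      ≤ 2 * Real.cot x ^ 3 * (Real.sin x ^ 3) ^ 2 := by gcongr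
    _ = 2 * (Real.sin x * Real.cos x) ^ 3 := by
      rw [Real.cot_eq_cos_div_sin]
      field_simp
    _ ≤ 2 * (x * (Real.pi / 2 - x)) ^ 3 := by
      have := hx.1.le
      gcongr

theorem memLp_radialMode (σ : ℕ) {p : ℝ} (hp : 3 ≤ p) :
    MemLp (fun x => (radialMode σ p x : ℂ)) 2 radialMeasure := by
  have hcont : ContinuousOn (fun x => (radialMode σ p x : ℂ)) (Ioo 0 (Real.pi / 2)) :=
    Complex.continuous_ofReal.comp_continuousOn (continuousOn_radialMode σ p)
  rw [memLp_two_iff_integrable_sq_norm hcont.aestronglyMeasurable_radial, integrable_radial_iff]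
  have hbd : IntegrableOn (fun x : ℝ => 2 * (x * (Real.pi / 2 - x)) ^ 3)
      (Ioo 0 (Real.pi / 2)) :=
    (Continuous.integrableOn_Icc (by fun_prop)).mono_set Ioo_subset_Icc_self
  refine Integrable.mono' hbd ?_ ?_
  · refine ContinuousOn.aestronglyMeasurable ?_ measurableSet_Ioo
    exact (continuousOn_const.mul (continuousOn_cot_radial.pow 3)).smul (hcont.norm.pow 2)
  · filter_upwards [ae_restrict_mem measurableSet_Ioo] with x hx
    have := cot_pos_radial hx
    rw [Complex.norm_real, smul_eq_mul, Real.norm_of_nonneg (by positivity), Real.norm_eq_abs,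
      sq_abs]
    exact weight_mul_radialMode_sq_le σ hp hx

/-- The class of `cos^σ x sin^p x` in `L²(dν)`. -/
noncomputable def radialModeL2 (σ : ℕ) {p : ℝ} (hp : 3 ≤ p) : RadialL2 :=
  (memLp_radialMode σ hp).toLp _

/-- Jordan's inequality bounds `x` by `2 sin x` and `π/2 - x` by `2 cos x`; the remaining factor is
at most `2`. -/
theorem tan_cot_mul_le {x : ℝ} (hx : x ∈ Ioo 0 (Real.pi / 2)) :
    Real.tan x * (x * (Real.pi / 2 - x)) ≤ 4 ∧ Real.cot x * (x * (Real.pi / 2 - x)) ≤ 4 := by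
  have hs := sin_pos_radial hx
  have hc := cos_pos_radial hx
  have hpi := Real.pi_pos
  have hpi4 := Real.pi_le_four
  have h1 : x ≤ Real.sin x * 2 := by
    have h := Real.mul_le_sin hx.1.le hx.2.le
    rw [div_mul_eq_mul_div, div_le_iff₀ hpi] at h
    nlinarith
  have h2 : Real.pi / 2 - x ≤ Real.cos x * 2 := by
    have h := Real.mul_le_sin (sub_pos.2 hx.2).le (by linarith [hx.1])
    rw [div_mul_eq_mul_div, div_le_iff₀ hpi, Real.sin_pi_div_two_sub] at h
    nlinarith
  rw [Real.tan_eq_sin_div_cos, Real.cot_eq_cos_div_sin, div_mul_eq_mul_div, div_mul_eq_mul_div,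
    div_le_iff₀ hc, div_le_iff₀ hs]
  have hsl := Real.sin_le_one x
  have hcl := Real.cos_le_one x
  have h0 := hx.1
  have h0' := sub_pos.2 hx.2
  constructor
  · calc Real.sin x * (x * (Real.pi / 2 - x)) ≤ 1 * (2 * (Real.cos x * 2)) := by
          gcongr
          linarith [hx.2]
      _ = 4 * Real.cos x := by ring
  · calc Real.cos x * (x * (Real.pi / 2 - x)) ≤ 1 * ((Real.sin x * 2) * 2) := by
          gcongr
          linarith [hx.1]
      _ = 4 * Real.sin x := by ring

/-- `L(s,λ)` applied to a cut off mode: the commutator with the cutoff function is supported where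
the cutoff function is not locally constant, and is bounded there. -/
theorem exists_radialExpr_cutoffMode {κ M lam p : ℝ} (s k : ℕ)
    (hp : p ^ 2 - 4 * p = (M ^ 2 + lam) / κ) : ∃ B : ℝ, 0 ≤ B ∧ ∀ n : ℕ, ∃ e : ℝ → ℝ,
      ∀ x ∈ Ioo 0 (Real.pi / 2),
        radialExpr κ M s lam (cutoffMode n (s + 2 * k) p) x =
          ((radialCutoff n x * radialModeImage s k p x + e x : ℝ) : ℂ) ∧
        |e x| * (x * (Real.pi / 2 - x)) ^ 2 ≤ B * radialMode (s + 2 * k) p x ∧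
        ((n + 1) * (x * (Real.pi / 2 - x)) ∉ Icc (1 : ℝ) 2 → e x = 0) := by
  obtain ⟨C, hC, hχ⟩ := exists_radialCutoff_derivs
  set σ := s + 2 * k with hσ
  refine ⟨C + C * (|3 + 2 * (σ : ℝ)| * 4 + |3 - 2 * p| * 4), by positivity, fun n => ?_⟩
  obtain ⟨χ₁, χ₂, d1, d2, hb⟩ := hχ n
  -- The commutator is `-χ'' g - 2 χ' g' + 3 (tan + cot) χ' g`, with `g' = (p cot - σ tan) g`.
  refine ⟨fun x => (-χ₂ x + χ₁ x * ((3 + 2 * (σ : ℝ)) * Real.tan x + (3 - 2 * p) * Real.cot x))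
    * radialMode σ p x, fun x hx => ⟨?_, ?_, fun h => ?_⟩⟩
  · have hg1 := fun (y : ℝ) (hy : y ∈ Ioo 0 (Real.pi / 2)) =>
      (d1 y).mul (hasDerivAt_radialMode σ p hy)
    have hg2 := ((d2 x).mul (hasDerivAt_radialMode σ p hx)).add
      ((d1 x).mul (hasDerivAt_deriv_radialMode σ p hx))
    refine (radialExpr_ofReal κ M s lam hx hg1 hg2).trans (congrArg _ ?_)
    rw [← radialMode_identity s k hp hx, ← hσ]
    simp only [Pi.mul_apply]
    ring
  · obtain ⟨b1, b2, -⟩ := hb x hx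
    obtain ⟨t1, t2⟩ := tan_cot_mul_le hx
    have hw := mul_sub_pos_radial_iff.2 hx
    have hs := sin_pos_radial hx
    have hc := cos_pos_radial hx
    have h4 : 0 ≤ radialMode σ p x := mul_nonneg (by positivity) (by positivity)
    have ht : 0 ≤ Real.tan x := by rw [Real.tan_eq_sin_div_cos]; positivity
    have hct := (cot_pos_radial hx).le
    set w := x * (Real.pi / 2 - x)
    rw [abs_mul, abs_of_nonneg h4, mul_right_comm]
    refine mul_le_mul_of_nonneg_right ?_ h4
    calc _ ≤ (|χ₂ x| + |χ₁ x| * (|3 + 2 * (σ : ℝ)| * Real.tan x + |3 - 2 * p| * Real.cot x))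
          * w ^ 2 := by
          refine mul_le_mul_of_nonneg_right ((abs_add_le _ _).trans ?_) (by positivity)
          rw [abs_neg, abs_mul]
          gcongr
          refine (abs_add_le _ _).trans_eq ?_
          rw [abs_mul, abs_mul, abs_of_nonneg ht, abs_of_nonneg hct]
      _ = |χ₂ x| * w ^ 2 + (|χ₁ x| * w) * (|3 + 2 * (σ : ℝ)| * (Real.tan x * w)
          + |3 - 2 * p| * (Real.cot x * w)) := by ring
      _ ≤ _ := by gcongr
  · obtain ⟨-, -, h0⟩ := hb x hx
    simp [h0 h]

theorem integral_concentration_le (n : ℕ) :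
    IntegrableOn ({x : ℝ | (n + 1) * (x * (Real.pi / 2 - x)) ≤ 2}.indicator
      fun _ => ((n : ℝ) + 1)) (Ioo 0 (Real.pi / 2)) ∧
    ∫ x in Ioo 0 (Real.pi / 2), {x : ℝ | (n + 1) * (x * (Real.pi / 2 - x)) ≤ 2}.indicator
      (fun _ => ((n : ℝ) + 1)) x ≤ 8 := by
  have hcl : MeasurableSet {x : ℝ | (n + 1) * (x * (Real.pi / 2 - x)) ≤ 2} :=
    (isClosed_le (by fun_prop) continuous_const).measurableSet
  have hn : (0 : ℝ) < n + 1 := by positivity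
  refine ⟨Integrable.indicator (integrable_const _) hcl, ?_⟩
  rw [setIntegral_indicator hcl, setIntegral_const, smul_eq_mul]
  -- On each half of the interval the distance to the far endpoint is at least `1/2`, so the
  -- distance to the near one is at most `4/(n+1)`.
  have hsub : Ioo 0 (Real.pi / 2) ∩ {x : ℝ | (n + 1) * (x * (Real.pi / 2 - x)) ≤ 2} ⊆
      Icc 0 (4 / (n + 1)) ∪ Icc (Real.pi / 2 - 4 / (n + 1)) (Real.pi / 2) := by
    rintro x ⟨hx, hxn⟩
    change (n + 1) * (x * (Real.pi / 2 - x)) ≤ 2 at hxn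
    have h0 := hx.1
    have h0' := sub_pos.2 hx.2
    have hpi := Real.pi_gt_three
    by_cases h : x ≤ Real.pi / 4
    · refine Or.inl ⟨h0.le, ?_⟩
      rw [le_div_iff₀ hn]
      have : (n + 1) * (x * (1 / 2)) ≤ (n + 1) * (x * (Real.pi / 2 - x)) := by
        gcongr
        linarith
      linarith
    · refine Or.inr ⟨?_, hx.2.le⟩
      rw [sub_le_comm, le_div_iff₀ hn]
      have : (n + 1) * ((1 / 2) * (Real.pi / 2 - x)) ≤ (n + 1) * (x * (Real.pi / 2 - x)) := by
        gcongr
        linarith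
      linarith
  have hvol : volume.real (Ioo 0 (Real.pi / 2) ∩ {x : ℝ | (n + 1) * (x * (Real.pi / 2 - x)) ≤ 2})
      ≤ 4 / (n + 1) + 4 / (n + 1) := by
    refine (measureReal_mono hsub ?_).trans ((measureReal_union_le _ _).trans_eq ?_)
    · exact (measure_union_lt_top (by simp) (by simp)).ne
    · rw [Real.volume_real_Icc_of_le (by positivity), Real.volume_real_Icc_of_le]
      · ring
      · have : 0 ≤ 4 / ((n : ℝ) + 1) := by positivity
        linarith
  calc _ ≤ (4 / ((n : ℝ) + 1) + 4 / (n + 1)) * (n + 1) := by gcongr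
    _ = 8 := by field_simp; norm_num

theorem memLp_radialModeImage (s k : ℕ) {p : ℝ} (hp : 3 ≤ p) :
    MemLp (fun x => (radialModeImage s k p x : ℂ)) 2 radialMeasure := by
  have h := ((memLp_radialMode (s + 2 * k) hp).const_mul ((s + 2 * k + p : ℂ) ^ 2)).sub
    ((memLp_radialMode (s + 2 * (k - 1)) hp).const_mul (4 * k * (k + s + 1) : ℂ))
  refine h.ae_eq (Eventually.of_forall fun x => ?_)
  simp only [radialModeImage, Pi.sub_apply]
  push_cast
  rfl

theorem toLp_radialModeImage (s k : ℕ) {p : ℝ} (hp : 3 ≤ p) :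
    (memLp_radialModeImage s k hp).toLp _ =
      (((s + 2 * k + p) ^ 2 : ℝ) : ℂ) • radialModeL2 (s + 2 * k) hp
        - ((4 * k * (k + s + 1) : ℝ) : ℂ) • radialModeL2 (s + 2 * (k - 1)) hp := by
  rw [radialModeL2, radialModeL2, ← MemLp.toLp_const_smul, ← MemLp.toLp_const_smul,
    ← MemLp.toLp_sub]
  refine MemLp.toLp_congr _ _ (Eventually.of_forall fun x => ?_)
  simp only [radialModeImage, Pi.sub_apply, Pi.smul_apply, smul_eq_mul]
  push_cast
  rfl

/-- The commutator term has weighted square at most `2B²(n+1)` and lives where `x (π/2 - x) ≤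
2/(n+1)`, a set of measure `O(1/(n+1))`. Its norm is therefore bounded uniformly in `n`. -/
theorem exists_norm_radialExprToL2_cutoffMode_le {κ M lam p : ℝ} (s k : ℕ) (hp3 : 3 ≤ p)
    (hp : p ^ 2 - 4 * p = (M ^ 2 + lam) / κ) :
    ∃ C : ℝ, ∀ n, ‖radialExprToL2 κ M s lam (cutoffMode n (s + 2 * k) p)‖ ≤ C := by
  obtain ⟨B, hB, hBe⟩ := exists_radialExpr_cutoffMode s k hp
  set I := radialModeImage s k p with hI
  have hImem := memLp_radialModeImage s k hp3
  have hIint := integrable_radial_iff.1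
    ((memLp_two_iff_integrable_sq_norm hImem.1).1 hImem)
  refine ⟨√(2 * (∫ x in Ioo 0 (Real.pi / 2), (2 * Real.cot x ^ 3) • ‖(I x : ℂ)‖ ^ 2)
    + 4 * B ^ 2 * 8), fun n => Real.le_sqrt_of_sq_le ?_⟩
  obtain ⟨e, he⟩ := hBe n
  obtain ⟨cInt, cLe⟩ := integral_concentration_le n
  set T : Set ℝ := {x : ℝ | (n + 1) * (x * (Real.pi / 2 - x)) ≤ 2} with hT
  change ‖(memLp_radialExpr κ M s lam (cutoffMode n (s + 2 * k) p)).toLp _‖ ^ 2 ≤ _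
  rw [norm_toLp_radial_sq, integral_radial]
  have hmem := memLp_radialExpr κ M s lam (cutoffMode n (s + 2 * k) p)
  have hint := integrable_radial_iff.1 ((memLp_two_iff_integrable_sq_norm hmem.1).1 hmem)
  calc _ ≤ ∫ x in Ioo 0 (Real.pi / 2), (2 * ((2 * Real.cot x ^ 3) • ‖(I x : ℂ)‖ ^ 2)
        + 4 * B ^ 2 * T.indicator (fun _ => ((n : ℝ) + 1)) x) := by
        refine setIntegral_mono_on hint ((hIint.const_mul 2).add (cInt.const_mul _))
          measurableSet_Ioo fun x hx => ?_
        obtain ⟨e1, e2, e3⟩ := he x hx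
        have hcot := cot_pos_radial hx
        have hw := mul_sub_pos_radial_iff.2 hx
        have hg := weight_mul_radialMode_sq_le (s + 2 * k) hp3 hx
        obtain ⟨c0, c1⟩ := radialCutoff_mem_Icc n x
        rw [e1, Complex.norm_real, Complex.norm_real, smul_eq_mul, smul_eq_mul, Real.norm_eq_abs,
          Real.norm_eq_abs, sq_abs, sq_abs]
        set w := x * (Real.pi / 2 - x) with hw'
        have hie : 2 * Real.cot x ^ 3 * e x ^ 2 ≤
            2 * B ^ 2 * T.indicator (fun _ => ((n : ℝ) + 1)) x := by
          by_cases hn : ((n : ℝ) + 1) * w ∈ Icc (1 : ℝ) 2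
          · rw [indicator_of_mem (show x ∈ T from hn.2)]
            have h1 : (|e x| * w ^ 2) ^ 2 ≤ (B * radialMode (s + 2 * k) p x) ^ 2 := by gcongr
            -- Scaling count: `|e| ≲ g / w²` and weight times `g²` is `≲ w³`, so weight times `e²`
            -- is `≲ w⁻¹`, which is at most of order `n + 1` because `(n+1) w ≥ 1`.
            have h2 : 2 * Real.cot x ^ 3 * e x ^ 2 * w ≤ 2 * B ^ 2 := by
              refine le_of_mul_le_mul_right ?_ (pow_pos hw 3)
              calc 2 * Real.cot x ^ 3 * e x ^ 2 * w * w ^ 3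
                  = 2 * Real.cot x ^ 3 * (|e x| * w ^ 2) ^ 2 := by rw [mul_pow |e x|, sq_abs]; ring
                _ ≤ 2 * Real.cot x ^ 3 * (B * radialMode (s + 2 * k) p x) ^ 2 := by gcongr
                _ = B ^ 2 * (2 * Real.cot x ^ 3 * radialMode (s + 2 * k) p x ^ 2) := by ring
                _ ≤ B ^ 2 * (2 * w ^ 3) := by gcongr
                _ = 2 * B ^ 2 * w ^ 3 := by ring
            calc 2 * Real.cot x ^ 3 * e x ^ 2
                ≤ 2 * Real.cot x ^ 3 * e x ^ 2 * (((n : ℝ) + 1) * w) :=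
                  le_mul_of_one_le_right (by positivity) hn.1
              _ = 2 * Real.cot x ^ 3 * e x ^ 2 * w * ((n : ℝ) + 1) := by ring
              _ ≤ _ := by gcongr
          · rw [e3 hn]
            have : 0 ≤ T.indicator (fun _ => ((n : ℝ) + 1)) x :=
              indicator_nonneg (fun _ _ => by positivity) x
            simp only [ne_eq, OfNat.ofNat_ne_zero, not_false_eq_true, zero_pow, mul_zero]
            positivity
        have hI2 : (radialCutoff n x * I x) ^ 2 ≤ I x ^ 2 := by
          rw [mul_pow]
          exact mul_le_of_le_one_left (sq_nonneg _) (pow_le_one₀ c0 c1)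
        calc 2 * Real.cot x ^ 3 * (radialCutoff n x * I x + e x) ^ 2
            ≤ 2 * Real.cot x ^ 3 * (2 * I x ^ 2 + 2 * e x ^ 2) := by
              gcongr
              nlinarith [sq_nonneg (radialCutoff n x * I x - e x)]
          _ = 2 * (2 * Real.cot x ^ 3 * I x ^ 2) + 2 * (2 * Real.cot x ^ 3 * e x ^ 2) := by ring
          _ ≤ _ := by linarith
    _ ≤ _ := by
      rw [integral_add (hIint.const_mul 2) (cInt.const_mul _), integral_const_mul,
        integral_const_mul]
      gcongr

theorem norm_testToL2_cutoffMode_le (n σ : ℕ) {p : ℝ} (hp : 3 ≤ p) :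
    ‖testToL2 (cutoffMode n σ p)‖ ≤ ‖radialModeL2 σ hp‖ := by
  refine Lp.norm_le_norm_of_ae_le ?_
  filter_upwards [(memLp_testFunction (cutoffMode n σ p)).coeFn_toLp,
    (memLp_radialMode σ hp).coeFn_toLp] with x h1 h2
  change ‖(memLp_testFunction (cutoffMode n σ p)).toLp _ x‖ ≤ ‖(memLp_radialMode σ hp).toLp _ x‖
  rw [h1, h2, cutoffMode_apply, Complex.ofReal_mul, norm_mul, Complex.norm_real]
  obtain ⟨c0, c1⟩ := radialCutoff_mem_Icc n x
  rw [Real.norm_of_nonneg c0]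
  exact mul_le_of_le_one_left (norm_nonneg _) c1

/-- The cutoff functions are eventually trivial on compact sets. -/
theorem eventually_two_lt_of_isCompact {K : Set ℝ} (hK : IsCompact K)
    (hKI : K ⊆ Ioo 0 (Real.pi / 2)) :
    ∀ᶠ n : ℕ in atTop, ∀ x ∈ K, 2 < ((n : ℝ) + 1) * (x * (Real.pi / 2 - x)) := by
  obtain ⟨m, hm, hmK⟩ := hK.exists_forall_le' (f := fun x : ℝ => x * (Real.pi / 2 - x)) (a := 0)
    (by fun_prop) fun x hx => mul_sub_pos_radial_iff.2 (hKI hx)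
  obtain ⟨N, hN⟩ := exists_nat_gt (2 / m)
  filter_upwards [eventually_ge_atTop N] with n hn x hx
  rw [div_lt_iff₀ hm] at hN
  have h1 : (N : ℝ) ≤ n := by exact_mod_cast hn
  calc 2 < N * m := hN
    _ ≤ (n + 1) * m := by gcongr; linarith
    _ ≤ (n + 1) * (x * (Real.pi / 2 - x)) := by gcongr; exact hmK x hx

/-- The functions `cos^(s+2k) x sin^p x` lie in the domain of the closure. -/
theorem radialModeL2_mem_closure_graph {κ M lam p : ℝ} (s k : ℕ) (hp3 : 3 ≤ p)
    (hp : p ^ 2 - 4 * p = (M ^ 2 + lam) / κ) :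
    (radialModeL2 (s + 2 * k) hp3, (((s + 2 * k + p) ^ 2 : ℝ) : ℂ) • radialModeL2 (s + 2 * k) hp3
        - ((4 * k * (k + s + 1) : ℝ) : ℂ) • radialModeL2 (s + 2 * (k - 1)) hp3)
      ∈ (radialOp κ M s lam).graph.topologicalClosure := by
  obtain ⟨C, hC⟩ := exists_norm_radialExprToL2_cutoffMode_le s k hp3 hp
  obtain ⟨B, -, hBe⟩ := exists_radialExpr_cutoffMode s k hp
  rw [← toLp_radialModeImage]
  refine mk_mem_topologicalClosure_of_weak dense_range_testToL2
    (u := fun n => testToL2 (cutoffMode n (s + 2 * k) p))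
    (y := fun n => radialExprToL2 κ M s lam (cutoffMode n (s + 2 * k) p))
    (fun n => ?_) (C := max ‖radialModeL2 (s + 2 * k) hp3‖ C)
    (fun n => (norm_testToL2_cutoffMode_le n _ hp3).trans (le_max_left _ _))
    (fun n => (hC n).trans (le_max_right _ _)) ?_ ?_
  · rw [LinearPMap.mem_graph_iff]
    exact ⟨⟨testToL2 (cutoffMode n (s + 2 * k) p), LinearMap.mem_range_self _ _⟩, rfl,
      radialOp_apply κ M s lam _⟩
  · rintro _ ⟨φ, rfl⟩
    -- Once the cutoff is one on the support of `φ`, the pairing with `φ` no longer depends on `n`.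
    filter_upwards [eventually_two_lt_of_isCompact φ.hasCompactSupport φ.tsupport_subset]
      with n hn
    change inner ℂ ((memLp_testFunction φ).toLp φ) ((memLp_testFunction _).toLp _) =
      inner ℂ ((memLp_testFunction φ).toLp φ) ((memLp_radialMode (s + 2 * k) hp3).toLp _)
    rw [inner_toLp_radial, inner_toLp_radial]
    refine integral_congr_ae (Eventually.of_forall fun x => ?_)
    by_cases hx : x ∈ tsupport φ
    · simp only [cutoffMode_apply, radialCutoff_eq_one (hn x hx).le, one_mul]
    · simp only [image_eq_zero_of_notMem_tsupport hx, map_zero, zero_mul]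
  · rintro _ ⟨φ, rfl⟩
    filter_upwards [eventually_two_lt_of_isCompact φ.hasCompactSupport φ.tsupport_subset]
      with n hn
    change inner ℂ ((memLp_testFunction φ).toLp φ) ((memLp_radialExpr _ _ _ _ _).toLp _) = _
    rw [show testToL2 φ = (memLp_testFunction φ).toLp φ from rfl, inner_toLp_radial,
      inner_toLp_radial]
    refine integral_congr_ae (Eventually.of_forall fun x => ?_)
    by_cases hx : x ∈ tsupport φ
    · obtain ⟨e, he⟩ := hBe n
      obtain ⟨e1, -, e3⟩ := he x (φ.tsupport_subset hx)
      have e0 := e3 fun h => absurd h.2 (not_le.2 (hn x hx))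
      simp only [e1, e0, radialCutoff_eq_one (hn x hx).le, one_mul, add_zero]
    · simp only [image_eq_zero_of_notMem_tsupport hx, map_zero, zero_mul]

end ModeInClosure

/-! ### Polynomials in `cos² x` times the ground mode: density. -/

section RadialPoly

open Filter Topology Polynomial

theorem memLp_eval_mul_radialMode (s : ℕ) {p : ℝ} (hp : 3 ≤ p) (P : ℝ[X]) :
    MemLp (fun x => ((P.eval (Real.cos x ^ 2) * radialMode s p x : ℝ) : ℂ)) 2 radialMeasure := by
  obtain ⟨C, hC⟩ := isCompact_Icc.exists_bound_of_continuousOn (s := Icc (0 : ℝ) 1)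
    P.continuous.continuousOn
  have hcont : ContinuousOn (fun x => ((P.eval (Real.cos x ^ 2) * radialMode s p x : ℝ) : ℂ))
      (Ioo 0 (Real.pi / 2)) :=
    Complex.continuous_ofReal.comp_continuousOn
      ((P.continuous.comp (Real.continuous_cos.pow 2)).continuousOn.mul
        (continuousOn_radialMode s p))
  refine (memLp_radialMode s hp).of_le_mul (c := C) hcont.aestronglyMeasurable_radial
    (Eventually.of_forall fun x => ?_)
  rw [Complex.ofReal_mul, norm_mul]
  gcongr
  rw [Complex.norm_real]
  exact hC _ ⟨sq_nonneg _, Real.cos_sq_le_one x⟩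

/-- The map `P ↦ P(cos² x) cos^s x sin^p x` from polynomials to `L²(dν)`. -/
noncomputable def radialPoly (s : ℕ) {p : ℝ} (hp : 3 ≤ p) : ℝ[X] →ₗ[ℝ] RadialL2 where
  toFun P := (memLp_eval_mul_radialMode s hp P).toLp _
  map_add' P Q := by
    rw [← MemLp.toLp_add]
    refine MemLp.toLp_congr _ _ (Eventually.of_forall fun x => ?_)
    simp [add_mul]
  map_smul' r P := by
    rw [RingHom.id_apply, ← MemLp.toLp_const_smul]
    refine MemLp.toLp_congr _ _ (Eventually.of_forall fun x => ?_)
    simp [mul_assoc]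

theorem coeFn_radialPoly (s : ℕ) {p : ℝ} (hp : 3 ≤ p) (P : ℝ[X]) :
    radialPoly s hp P =ᵐ[radialMeasure]
      fun x => ((P.eval (Real.cos x ^ 2) * radialMode s p x : ℝ) : ℂ) :=
  (memLp_eval_mul_radialMode s hp P).coeFn_toLp

theorem radialPoly_X_pow (s k : ℕ) {p : ℝ} (hp : 3 ≤ p) :
    radialPoly s hp (X ^ k) = radialModeL2 (s + 2 * k) hp := by
  refine MemLp.toLp_congr (memLp_eval_mul_radialMode s hp _) (memLp_radialMode _ hp)
    (Eventually.of_forall fun x => ?_)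
  simp only [radialMode, eval_pow, eval_X, pow_add, pow_mul]
  push_cast
  ring

theorem inner_radialPoly (s : ℕ) {p : ℝ} (hp : 3 ≤ p) (P Q : ℝ[X]) :
    inner ℂ (radialPoly s hp P) (radialPoly s hp Q) =
      ((∫ x in Ioo 0 (Real.pi / 2), 2 * Real.cot x ^ 3 *
        (P.eval (Real.cos x ^ 2) * Q.eval (Real.cos x ^ 2) * radialMode s p x ^ 2) : ℝ) : ℂ) := by
  refine (inner_toLp_radial (memLp_eval_mul_radialMode s hp P)
    (memLp_eval_mul_radialMode s hp Q)).trans ?_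
  rw [integral_radial, ← integral_complex_ofReal]
  refine setIntegral_congr_fun measurableSet_Ioo fun x _ => ?_
  simp only [Complex.conj_ofReal, Complex.real_smul]
  push_cast
  ring

/-- The functions `P(cos² x) cos^s x sin^p x` with a complex polynomial `P` are dense. -/
theorem topologicalClosure_eq_top_of_radialPoly_mem (s : ℕ) {p : ℝ} (hp : 3 ≤ p)
    {V : Submodule ℂ RadialL2}
    (hV : ∀ P, radialPoly s hp P ∈ V) : V.topologicalClosure = ⊤ := by
  rw [← Submodule.dense_iff_topologicalClosure_eq_top]
  suffices h : ∀ φ : 𝓓(radialInterval, ℂ), testToL2 φ ∈ closure (V : Set RadialL2) by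
    refine dense_range_testToL2.mono ?_ |>.of_closure
    rintro _ ⟨φ, rfl⟩
    exact h φ
  intro φ
  -- Since `φ` has compact support in the interval, where the mode is nonzero, the quotient is
  -- continuous. A uniform approximation of it by polynomials in `cos² x` becomes an `L²`
  -- approximation of `φ` after multiplication by the mode.
  set h : ℝ → ℂ := fun x => φ x / radialMode s p x with hh
  have hmode : ∀ x ∈ Ioo 0 (Real.pi / 2), radialMode s p x ≠ 0 := fun x hx =>
    (mul_pos (pow_pos (cos_pos_radial hx) _) (Real.rpow_pos_of_pos (sin_pos_radial hx) _)).ne'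
  have hcont : Continuous h := by
    refine continuous_of_tsupport fun x hx => ?_
    have hsub : tsupport h ⊆ tsupport φ :=
      closure_mono fun y hy h0 => hy (by simp [hh, h0])
    have hxI := φ.tsupport_subset (hsub hx)
    refine φ.continuous.continuousAt.div ?_ (by exact_mod_cast hmode x hxI)
    exact Complex.continuous_ofReal.continuousAt.comp (contDiffAt_radialMode s p hxI).continuousAt
  -- Inverse of the substitution `t = cos² x` on the interval.
  set T : ℝ → ℝ := fun t => Real.arccos √t with hT
  have hTcont : Continuous T := Real.continuous_arccos.comp Real.continuous_sqrt
  have hTcos : ∀ x ∈ Ioo 0 (Real.pi / 2), T (Real.cos x ^ 2) = x := fun x hx => by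
    simp only [hT]
    rw [Real.sqrt_sq (cos_pos_radial hx).le, Real.arccos_cos hx.1.le
      (by linarith [hx.2, Real.pi_pos])]
  rw [Metric.mem_closure_iff]
  intro ε hε
  set δ : ℝ := ε / (2 * (‖radialModeL2 s hp‖ + 1)) with hδ
  have hδ0 : 0 < δ := by positivity
  obtain ⟨P, hP⟩ := exists_polynomial_near_of_continuousOn 0 1 (fun t => (h (T t)).re)
    (by fun_prop) δ hδ0
  obtain ⟨Q, hQ⟩ := exists_polynomial_near_of_continuousOn 0 1 (fun t => (h (T t)).im)
    (by fun_prop) δ hδ0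
  refine ⟨_, V.add_mem (hV P) (V.smul_mem Complex.I (hV Q)), ?_⟩
  rw [dist_eq_norm]
  have key : ‖testToL2 φ - (radialPoly s hp P + Complex.I • radialPoly s hp Q)‖ ≤
      (2 * δ) * ‖radialModeL2 s hp‖ := by
    refine Lp.norm_le_mul_norm_of_ae_le_mul ?_
    filter_upwards [(memLp_testFunction φ).coeFn_toLp, (memLp_radialMode s hp).coeFn_toLp,
      coeFn_radialPoly s hp P, coeFn_radialPoly s hp Q, ae_radial_mem,
      Lp.coeFn_sub (testToL2 φ) (radialPoly s hp P + Complex.I • radialPoly s hp Q),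
      Lp.coeFn_add (radialPoly s hp P) (Complex.I • radialPoly s hp Q),
      Lp.coeFn_smul Complex.I (radialPoly s hp Q)] with x x1 x2 x3 x4 hx x5 x6 x7
    rw [x5, Pi.sub_apply, x6, Pi.add_apply, x7, Pi.smul_apply, x3, x4]
    change ‖(memLp_testFunction φ).toLp φ x - _‖ ≤ _ * ‖(memLp_radialMode s hp).toLp _ x‖
    rw [x1, x2]
    have hm := hmode x hx
    have ht : Real.cos x ^ 2 ∈ Icc (0 : ℝ) 1 := ⟨sq_nonneg _, Real.cos_sq_le_one x⟩
    have p1 := hP _ ht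
    have q1 := hQ _ ht
    rw [hTcos x hx] at p1 q1
    have e1 : φ x = h x * radialMode s p x := by
      rw [hh]
      field_simp [(by exact_mod_cast hm : (radialMode s p x : ℂ) ≠ 0)]
    have e2 : φ x - (((P.eval (Real.cos x ^ 2) * radialMode s p x : ℝ) : ℂ)
        + Complex.I • ((Q.eval (Real.cos x ^ 2) * radialMode s p x : ℝ) : ℂ))
        = (h x - (P.eval (Real.cos x ^ 2) + Q.eval (Real.cos x ^ 2) * Complex.I))
          * radialMode s p x := by
      rw [e1, smul_eq_mul]
      push_cast
      ring
    rw [e2, norm_mul]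
    gcongr
    refine (Complex.norm_le_abs_re_add_abs_im _).trans ?_
    simp only [Complex.sub_re, Complex.add_re, Complex.ofReal_re, Complex.mul_re, Complex.I_re,
      mul_zero, Complex.ofReal_im, Complex.I_im, mul_one, sub_self, add_zero, Complex.sub_im,
      Complex.add_im, Complex.mul_im, zero_add]
    rw [abs_sub_comm] at p1 q1
    linarith
  refine key.trans_lt ?_
  rw [hδ]
  have hn := norm_nonneg (radialModeL2 s hp)
  rw [show 2 * (ε / (2 * (‖radialModeL2 s hp‖ + 1))) * ‖radialModeL2 s hp‖
    = ε * ‖radialModeL2 s hp‖ / (‖radialModeL2 s hp‖ + 1) by field_simp]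
  rw [div_lt_iff₀ (by positivity)]
  linarith

/-! ### The Beta integral. -/

/-- The Beta integral in trigonometric form. -/
theorem integral_cos_pow_mul_sin_rpow (m : ℕ) : ∀ {β : ℝ}, 0 ≤ β →
    ∫ x in (0)..(Real.pi / 2), 2 * (Real.cos x ^ (2 * m + 1) * Real.sin x ^ (2 * β + 1)) =
      m.factorial * Real.Gamma (β + 1) / Real.Gamma (β + m + 2) := by
  have hrpow : ∀ {γ : ℝ}, 0 ≤ γ → Continuous fun x => Real.sin x ^ γ := fun hγ =>
    Real.continuous_sin.rpow_const fun _ => Or.inr hγ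
  have hder : ∀ {β : ℝ}, 0 ≤ β → ∀ x, HasDerivAt (fun x => Real.sin x ^ (2 * β + 2))
      (Real.cos x * (2 * β + 2) * Real.sin x ^ (2 * β + 1)) x := fun {β} hβ x => by
    refine ((Real.hasDerivAt_sin x).rpow_const (p := 2 * β + 2) (Or.inr (by linarith))).congr_deriv
      ?_
    rw [show 2 * β + 2 - 1 = 2 * β + 1 by ring]
  induction m with
  | zero =>
    intro β hβ
    have h := intervalIntegral.integral_eq_sub_of_hasDerivAt (a := 0) (b := Real.pi / 2)
      (fun x _ => hder hβ x)
      (((Real.continuous_cos.mul continuous_const).mul (hrpow (by linarith))).intervalIntegrable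
        _ _)
    rw [Real.sin_pi_div_two, Real.sin_zero, Real.one_rpow, Real.zero_rpow (by linarith)] at h
    have h2 : ∫ x in (0)..(Real.pi / 2),
        2 * (Real.cos x ^ (2 * 0 + 1) * Real.sin x ^ (2 * β + 1)) = 1 / (β + 1) *
        ∫ x in (0)..(Real.pi / 2), Real.cos x * (2 * β + 2) * Real.sin x ^ (2 * β + 1) := by
      rw [← intervalIntegral.integral_const_mul]
      congr 1
      funext x
      field_simp
      ring
    have := (Real.Gamma_pos_of_pos (show 0 < β + 1 by positivity)).ne'
    rw [h2, h, Nat.cast_zero, add_zero, show β + 2 = β + 1 + 1 by ring,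
      Real.Gamma_add_one (show β + 1 ≠ 0 by positivity), Nat.factorial_zero, Nat.cast_one]
    field_simp
    norm_num
  | succ m ih =>
    intro β hβ
    -- Writing `I(m, β)` for the integral, integration of the derivative of `cos^(2m+2) sin^(2β+2)`,
    -- which vanishes at both ends, gives `(β+1) I(m+1, β) = (m+1) I(m, β+1)`.
    have h := intervalIntegral.integral_eq_sub_of_hasDerivAt (a := 0) (b := Real.pi / 2)
      (fun x _ => ((Real.hasDerivAt_cos x).pow (2 * m + 2)).mul (hder hβ x)) (by
        refine Continuous.intervalIntegrable ?_ _ _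
        have := hrpow (show 0 ≤ 2 * β + 1 by linarith)
        have := hrpow (show 0 ≤ 2 * β + 2 by linarith)
        simp only [Pi.pow_apply]
        fun_prop)
    have e : ∀ x ∈ uIcc 0 (Real.pi / 2),
        ((2 * m + 2 : ℕ) : ℝ) * Real.cos x ^ (2 * m + 2 - 1) * -Real.sin x
            * Real.sin x ^ (2 * β + 2)
          + (Real.cos ^ (2 * m + 2)) x * (Real.cos x * (2 * β + 2) * Real.sin x ^ (2 * β + 1))
        = (β + 1) * (2 * (Real.cos x ^ (2 * (m + 1) + 1) * Real.sin x ^ (2 * β + 1)))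
          - (m + 1) * (2 * (Real.cos x ^ (2 * m + 1) * Real.sin x ^ (2 * (β + 1) + 1))) := by
      intro x hx
      rw [uIcc_of_le (by positivity)] at hx
      have hs : 0 ≤ Real.sin x :=
        Real.sin_nonneg_of_nonneg_of_le_pi hx.1 (by linarith [hx.2, Real.pi_pos])
      have h1 : Real.sin x ^ (2 * (β + 1) + 1) = Real.sin x * Real.sin x ^ (2 * β + 2) := by
        rw [show 2 * (β + 1) + 1 = 1 + (2 * β + 2) by ring,
          Real.rpow_add_of_nonneg hs zero_le_one (by linarith), Real.rpow_one]
      rw [h1, Pi.pow_apply]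
      push_cast
      ring
    rw [intervalIntegral.integral_congr e] at h
    have hc1 := hrpow (show 0 ≤ 2 * β + 1 by linarith)
    have hc2 := hrpow (show 0 ≤ 2 * (β + 1) + 1 by linarith)
    rw [intervalIntegral.integral_sub (Continuous.intervalIntegrable (by fun_prop) _ _)
      (Continuous.intervalIntegrable (by fun_prop) _ _),
      intervalIntegral.integral_const_mul (β + 1),
      intervalIntegral.integral_const_mul ((m : ℝ) + 1), ih (by linarith : 0 ≤ β + 1)] at h
    simp only [Pi.mul_apply, Pi.pow_apply, Real.cos_pi_div_two, Real.sin_zero] at h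
    rw [Real.zero_rpow (by linarith), zero_pow (by omega), zero_mul, mul_zero, sub_zero,
      sub_eq_zero, show β + 1 + m + 2 = β + (m + 1 : ℕ) + 2 by push_cast; ring,
      Real.Gamma_add_one (show β + 1 ≠ 0 by positivity)] at h
    have hb : (β + 1) ≠ 0 := by positivity
    refine mul_left_cancel₀ hb (h.trans ?_)
    rw [Nat.factorial_succ]
    push_cast
    ring

end RadialPoly

/-! ### Jacobi coefficients and their inner products. -/

section Jacobi

open Filter Topology Polynomial

/-- The coefficients of the Jacobi polynomial `P_n^{(a,b)}(1 - 2t)` in powers of `t`. -/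
noncomputable def jacobiCoeff (n : ℕ) (a b : ℝ) (k : ℕ) : ℝ :=
  (1 / (n.factorial : ℝ)) * ((n.choose k : ℝ) * (ascPochhammer ℝ k).eval ((n : ℝ) + a + b + 1)
    * (ascPochhammer ℝ (n - k)).eval (a + k + 1)) * (-1) ^ k

/-- The Jacobi polynomial `P_n^{(a,b)}(1 - 2t)` as a polynomial in `t`. -/
noncomputable def jacobiPoly (n : ℕ) (a b : ℝ) : ℝ[X] :=
  ∑ k ∈ Finset.range (n + 1), C (jacobiCoeff n a b k) * X ^ k

theorem jacobiP_neg_cos_two_mul (n : ℕ) (a b x : ℝ) :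
    jacobiP n a b (-Real.cos (2 * x)) = (jacobiPoly n a b).eval (Real.cos x ^ 2) := by
  rw [jacobiP, jacobiPoly, eval_finsetSum, Finset.mul_sum]
  refine Finset.sum_congr rfl fun k _ => ?_
  rw [show (-Real.cos (2 * x) - 1) / 2 = -1 * Real.cos x ^ 2 by rw [Real.cos_two_mul]; ring,
    mul_pow, jacobiCoeff, eval_mul, eval_C, eval_pow, eval_X]
  ring

theorem jacobiCoeff_eq_zero {n k : ℕ} (a b : ℝ) (h : n < k) : jacobiCoeff n a b k = 0 := by
  simp [jacobiCoeff, Nat.choose_eq_zero_of_lt h]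

theorem coeff_jacobiPoly (n : ℕ) (a b : ℝ) (k : ℕ) :
    (jacobiPoly n a b).coeff k = jacobiCoeff n a b k := by
  rw [jacobiPoly, finsetSum_coeff]
  simp only [coeff_C_mul, coeff_X_pow, mul_ite, mul_one, mul_zero, Finset.sum_ite_eq,
    Finset.mem_range]
  split_ifs with h
  · rfl
  · exact (jacobiCoeff_eq_zero a b (by omega)).symm

/-- This is the hypergeometric recurrence, equivalent to the Jacobi differential equation. It comes
from `(k+1) C(n,k+1) = (n-k) C(n,k)` and the two Pochhammer recursions. -/
theorem jacobiCoeff_succ_mul (n : ℕ) (a b : ℝ) (k : ℕ) :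
    (k + 1) * (k + a + 1) * jacobiCoeff n a b (k + 1) =
      -((n - k) * (n + a + b + 1 + k)) * jacobiCoeff n a b k := by
  rcases lt_trichotomy k n with h | rfl | h
  · obtain ⟨m, rfl⟩ := Nat.exists_eq_add_of_lt h
    have h1 : ((k + m + 1).choose (k + 1) : ℝ) * (k + 1) = (k + m + 1).choose k * (m + 1) := by
      have := Nat.choose_succ_right_eq (k + m + 1) k
      rw [show k + m + 1 - k = m + 1 by omega] at this
      exact_mod_cast this
    have h2 : (ascPochhammer ℝ (m + 1)).eval (a + k + 1) =
        (a + k + 1) * (ascPochhammer ℝ m).eval (a + k + 1 + 1) := by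
      rw [ascPochhammer_succ_left, eval_mul, eval_X, eval_comp, eval_add, eval_X, eval_one]
    rw [jacobiCoeff, jacobiCoeff, ascPochhammer_succ_eval, show k + m + 1 - (k + 1) = m by omega,
      show k + m + 1 - k = m + 1 by omega, h2]
    push_cast
    rw [show a + (k + 1 : ℝ) + 1 = a + k + 1 + 1 by ring, pow_succ]
    linear_combination (-(1 / ((k + m + 1).factorial : ℝ)) * (k + a + 1) *
      ((ascPochhammer ℝ k).eval ((k : ℝ) + m + 1 + a + b + 1) * ((k : ℝ) + m + 1 + a + b + 1 + k))
      * (ascPochhammer ℝ m).eval (a + k + 1 + 1) * (-1) ^ k) * h1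
  · simp [jacobiCoeff_eq_zero a b (Nat.lt_succ_self k)]
  · rw [jacobiCoeff_eq_zero a b h, jacobiCoeff_eq_zero a b (by omega : n < k + 1)]
    simp

theorem jacobiCoeff_self (n : ℕ) (a b : ℝ) : jacobiCoeff n a b n =
    (-1) ^ n * ((ascPochhammer ℝ n).eval ((n : ℝ) + a + b + 1) / n.factorial) := by
  simp [jacobiCoeff]
  ring

/-- A linear subspace of polynomials that contains one polynomial of each degree below `n` contains
all polynomials of degree below `n`. -/
theorem Polynomial.mem_of_forall_coeff_eq_zero {K : Type*} [Field K] {V : Submodule K K[X]}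
    {J : ℕ → K[X]} (h0 : ∀ i, (J i).coeff i ≠ 0) (h1 : ∀ i k, i < k → (J i).coeff k = 0) {n : ℕ} :
    (∀ i < n, J i ∈ V) → ∀ P : K[X], (∀ k, n ≤ k → P.coeff k = 0) → P ∈ V := by
  induction n with
  | zero =>
    intro _ P hP
    have : P = 0 := by
      ext k
      simpa using hP k (Nat.zero_le k)
    rw [this]
    exact V.zero_mem
  | succ n ih =>
    intro hJ P hP
    set r := P.coeff n / (J n).coeff n with hr
    have h : P - r • J n ∈ V := by
      refine ih (fun i hi => hJ i (by omega)) _ fun k hk => ?_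
      rw [coeff_sub, coeff_smul, smul_eq_mul]
      rcases hk.eq_or_lt with rfl | hk
      · rw [hr, div_mul_cancel₀ _ (h0 n), sub_self]
      · rw [hP k hk, h1 n k hk, mul_zero, sub_zero]
    have := V.add_mem h (V.smul_mem r (hJ n (Nat.lt_succ_self n)))
    rwa [sub_add_cancel] at this

theorem ascPochhammer_eval_mul_Gamma {z : ℝ} (hz : 0 < z) (k : ℕ) :
    (ascPochhammer ℝ k).eval z * Real.Gamma z = Real.Gamma (z + k) := by
  induction k with
  | zero => simp
  | succ k ih =>
    rw [ascPochhammer_succ_eval, mul_right_comm, ih, Nat.cast_succ, ← add_assoc,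
      Real.Gamma_add_one (by positivity), mul_comm]

/-- Partial fractions of `n! / (z (z+1) ⋯ (z+n))`. By Pascal's rule the sum for `n + 1` at `z` is
the difference of the sums for `n` at `z` and at `z + 1`. -/
theorem sum_neg_one_pow_mul_choose_div (n : ℕ) : ∀ {z : ℝ}, 0 < z →
    ∑ k ∈ Finset.range (n + 1), (-1) ^ k * (n.choose k : ℝ) / (z + k) =
      n.factorial / (ascPochhammer ℝ (n + 1)).eval z := by
  induction n with
  | zero => simp
  | succ n ih =>
    intro z hz
    have h1 : ∑ k ∈ Finset.range (n + 1 + 1), (-1) ^ k * ((n + 1).choose k : ℝ) / (z + k) =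
        ∑ k ∈ Finset.range (n + 1), (-1) ^ k * (n.choose k : ℝ) / (z + k)
        - ∑ k ∈ Finset.range (n + 1), (-1) ^ k * (n.choose k : ℝ) / (z + 1 + k) := by
      have h2 : ∑ k ∈ Finset.range (n + 1), (-1) ^ k * (n.choose k : ℝ) / (z + k) =
          ∑ k ∈ Finset.range (n + 1 + 1), (-1) ^ k * (n.choose k : ℝ) / (z + k) := by
        rw [Finset.sum_range_succ _ (n + 1)]
        simp
      rw [h2, Finset.sum_range_succ', Finset.sum_range_succ' _ (n + 1), add_sub_right_comm,
        ← Finset.sum_sub_distrib]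
      congr 1
      · refine Finset.sum_congr rfl fun k _ => ?_
        rw [Nat.choose_succ_succ', pow_succ]
        push_cast
        rw [show z + (k + 1 : ℝ) = z + 1 + k by ring]
        ring
      · simp
    have hp : 0 < (ascPochhammer ℝ n).eval (z + 1) := ascPochhammer_pos n _ (by positivity)
    have e1 : (ascPochhammer ℝ (n + 1)).eval z = z * (ascPochhammer ℝ n).eval (z + 1) := by
      rw [ascPochhammer_succ_left, eval_mul, eval_X, eval_comp, eval_add, eval_X, eval_one]
    have e2 : (ascPochhammer ℝ (n + 1 + 1)).eval z =
        z * ((ascPochhammer ℝ n).eval (z + 1) * (z + 1 + n)) := by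
      rw [ascPochhammer_succ_left, eval_mul, eval_X, eval_comp, eval_add, eval_X, eval_one,
        ascPochhammer_succ_eval]
    rw [h1, ih hz, ih (by positivity : 0 < z + 1), e1, e2, ascPochhammer_succ_eval,
      Nat.factorial_succ]
    have : 0 < z + 1 + n := by positivity
    push_cast
    field_simp
    ring

theorem real_smul_radialL2 (r : ℝ) (v : RadialL2) : r • v = (r : ℂ) • v :=
  (algebraMap_smul ℂ r v).symm

theorem three_le_two_add {c : ℝ} (hc : 2 ≤ c) : 3 ≤ 2 + c := by linarith

/-- The integrand is `2 cos^(2(s+1+k)+1) sin^(2(c+n)+1)`, a Beta integral. -/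
theorem inner_radialPoly_X_pow (s k n : ℕ) {c : ℝ} (hc : 2 ≤ c) :
    inner ℂ (radialPoly s (three_le_two_add hc) (X ^ k))
      (radialPoly s (three_le_two_add hc) ((1 - X) ^ n)) =
      (((s + 1 + k).factorial * Real.Gamma (c + n + 1) / Real.Gamma (c + n + (s + 1 + k : ℕ) + 2) :
        ℝ) : ℂ) := by
  rw [inner_radialPoly, ← integral_cos_pow_mul_sin_rpow (s + 1 + k) (by positivity : 0 ≤ c + n),
    intervalIntegral.integral_of_le (by positivity), integral_Ioc_eq_integral_Ioo]
  congr 1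
  refine setIntegral_congr_fun measurableSet_Ioo fun x hx => ?_
  have hs := sin_pos_radial hx
  simp only [eval_pow, eval_X, eval_sub, eval_one, radialMode, Real.cot_eq_cos_div_sin]
  have h1 : 1 - Real.cos x ^ 2 = Real.sin x ^ 2 := by linarith [Real.sin_sq_add_cos_sq x]
  have h2 : Real.sin x ^ (2 * (c + n) + 1) * Real.sin x ^ 3 =
      (Real.sin x ^ 2) ^ n * (Real.sin x ^ (2 + c)) ^ 2 := by
    rw [← pow_mul, ← Real.rpow_natCast _ 3, ← Real.rpow_natCast _ (2 * n), ← Real.rpow_natCast _ 2,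
      ← Real.rpow_mul hs.le, ← Real.rpow_add hs, ← Real.rpow_add hs]
    congr 1
    push_cast
    ring
  rw [h1]
  have h3 : Real.sin x ^ (2 * (c + n) + 1) =
      (Real.sin x ^ 2) ^ n * (Real.sin x ^ (2 + c)) ^ 2 / Real.sin x ^ 3 := by
    rw [eq_div_iff (by positivity), h2]
  rw [h3]
  field_simp
  ring

/-- Testing against `(1-X)^n` makes the sum collapse: `(s+1+k)!` and the Pochhammer factor of the
coefficient combine to `(s+1+n)!`, the Gamma factors leave `1/(z+k)`, and the partial fraction
identity applies. -/
theorem inner_jacobiPoly_one_sub_X_pow (s n : ℕ) {c : ℝ} (hc : 2 ≤ c) :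
    inner ℂ (radialPoly s (three_le_two_add hc) (jacobiPoly n (s + 1) c))
      (radialPoly s (three_le_two_add hc) ((1 - X) ^ n)) =
      (((s + 1 + n).factorial * Real.Gamma (c + n + 1) / (Real.Gamma (n + s + c + 2) *
        (ascPochhammer ℝ (n + 1)).eval (n + s + c + 2)) : ℝ) : ℂ) := by
  set z : ℝ := n + s + c + 2 with hz
  have hz0 : 0 < z := by positivity
  have hterm : ∀ k ∈ Finset.range (n + 1), jacobiCoeff n (s + 1) c k *
      ((s + 1 + k).factorial * Real.Gamma (c + n + 1) / Real.Gamma (c + n + (s + 1 + k : ℕ) + 2))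
      = (s + 1 + n).factorial * Real.Gamma (c + n + 1) / (n.factorial * Real.Gamma z) *
        ((-1) ^ k * (n.choose k : ℝ) / (z + k)) := by
    intro k hk
    have hkn : k ≤ n := by simpa [Nat.lt_succ_iff] using hk
    have e1 : ((s + 1 + k).factorial : ℝ) * (ascPochhammer ℝ (n - k)).eval ((s : ℝ) + 1 + k + 1)
        = (s + 1 + n).factorial := by
      have h := Nat.factorial_mul_ascFactorial (s + 1 + k) (n - k)
      rw [show s + 1 + k + (n - k) = s + 1 + n by omega, ← ascPochhammer_nat_eq_ascFactorial] at h
      rw [← h]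
      push_cast
      rfl
    have e2 := ascPochhammer_eval_mul_Gamma hz0 k
    have e3 : Real.Gamma (c + n + (s + 1 + k : ℕ) + 2) = (z + k) * Real.Gamma (z + k) := by
      rw [← Real.Gamma_add_one (by positivity)]
      congr 1
      push_cast
      ring
    have hg : 0 < Real.Gamma z := Real.Gamma_pos_of_pos hz0
    have hgk : 0 < Real.Gamma (z + k) := Real.Gamma_pos_of_pos (by positivity)
    have hzk : 0 < z + k := by positivity
    rw [jacobiCoeff, show (n : ℝ) + (s + 1) + c + 1 = z by rw [hz]; ring, e3, ← e1, ← e2]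
    rw [← e2] at hgk
    have hpo : 0 < (ascPochhammer ℝ k).eval z := ascPochhammer_pos k z hz0
    field_simp
  have hsum : ∑ k ∈ Finset.range (n + 1), jacobiCoeff n (s + 1) c k *
      ((s + 1 + k).factorial * Real.Gamma (c + n + 1) / Real.Gamma (c + n + (s + 1 + k : ℕ) + 2))
      = (s + 1 + n).factorial * Real.Gamma (c + n + 1) / (Real.Gamma z *
        (ascPochhammer ℝ (n + 1)).eval z) := by
    rw [Finset.sum_congr rfl hterm, ← Finset.mul_sum, sum_neg_one_pow_mul_choose_div n hz0]
    have := (ascPochhammer_pos (n + 1) z hz0).ne'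
    have := (Real.Gamma_pos_of_pos hz0).ne'
    field_simp
  rw [← hsum, jacobiPoly, map_sum, sum_inner, Complex.ofReal_sum]
  refine Finset.sum_congr rfl fun k _ => ?_
  rw [← smul_eq_C_mul, map_smul, real_smul_radialL2, inner_smul_left,
    inner_radialPoly_X_pow s k n hc,
    Complex.conj_ofReal, ← Complex.ofReal_mul]

end Jacobi

/-! ### Eigenvectors of the closure, orthogonality and normalisation. -/

section Eigenfunctions

open Filter Topology Polynomial

theorem two_le_radialC {κ M lam : ℝ} (hκ : 0 < κ) (hlam : 0 ≤ lam) : 2 ≤ radialC κ M lam := by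
  refine Real.le_sqrt_of_sq_le ?_
  have : 0 ≤ (M ^ 2 + lam) / κ := by positivity
  linarith

/-- The definition of `c` makes `2 + c` a root of the indicial equation at `0`. -/
theorem radialC_indicial {κ M lam : ℝ} (hκ : 0 < κ) (hlam : 0 ≤ lam) :
    (2 + radialC κ M lam) ^ 2 - 4 * (2 + radialC κ M lam) = (M ^ 2 + lam) / κ := by
  have h : radialC κ M lam ^ 2 = 4 + (M ^ 2 + lam) / κ := Real.sq_sqrt (by positivity)
  linear_combination h

/-- The Jacobi polynomials give eigenfunctions of the closure. -/
theorem radialPoly_jacobiPoly_mem_closure_graph {κ M lam c : ℝ} (s n : ℕ) (hc : 2 ≤ c)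
    (hp : (2 + c) ^ 2 - 4 * (2 + c) = (M ^ 2 + lam) / κ) :
    (radialPoly s (three_le_two_add hc) (jacobiPoly n (s + 1) c),
      (((2 * n + s + c + 2) ^ 2 : ℝ) : ℂ) •
        radialPoly s (three_le_two_add hc) (jacobiPoly n (s + 1) c))
      ∈ (radialOp κ M s lam).graph.topologicalClosure := by
  set q := jacobiCoeff n (s + 1) c with hq
  have hmem : ∀ k, (radialPoly s (three_le_two_add hc) (C (q k) * X ^ k),
      radialPoly s (three_le_two_add hc) (C (q k * (s + 2 * k + (2 + c)) ^ 2) * X ^ k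
        - C (q k * (4 * k * (k + s + 1))) * X ^ (k - 1)))
      ∈ (radialOp κ M s lam).graph.topologicalClosure := by
    intro k
    have h := Submodule.smul_mem _ (q k : ℂ)
      (radialModeL2_mem_closure_graph s k (three_le_two_add hc) hp)
    rw [Prod.smul_mk] at h
    rwa [map_sub, ← smul_eq_C_mul, ← smul_eq_C_mul, ← smul_eq_C_mul, map_smul, map_smul, map_smul,
      radialPoly_X_pow, radialPoly_X_pow, real_smul_radialL2, real_smul_radialL2,
      real_smul_radialL2, Complex.ofReal_mul, Complex.ofReal_mul (q k), mul_smul, mul_smul,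
      ← smul_sub]
  have hsum := Submodule.sum_mem _ (t := Finset.range (n + 1)) fun k _ => hmem k
  rw [← prod_mk_sum, ← map_sum, ← map_sum] at hsum
  have hpoly : ∑ k ∈ Finset.range (n + 1), (C (q k * (s + 2 * k + (2 + c)) ^ 2) * X ^ k
        - C (q k * (4 * k * (k + s + 1))) * X ^ (k - 1))
      = ((2 * n + s + c + 2) ^ 2 : ℝ) • jacobiPoly n (s + 1) c := by
    -- Index shift: the term `k = 0` carries the factor `k`, and the new top term vanishes since `q
    -- (n+1) = 0`.
    have h1 : ∑ k ∈ Finset.range (n + 1), C (q k * (4 * k * (k + s + 1))) * X ^ (k - 1) =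
        ∑ k ∈ Finset.range (n + 1), C (q (k + 1) * (4 * (k + 1) * (k + 1 + s + 1))) * X ^ k := by
      rw [Finset.sum_range_succ', Finset.sum_range_succ, hq,
        jacobiCoeff_eq_zero _ _ (Nat.lt_succ_self n)]
      simp
    rw [Finset.sum_sub_distrib, h1, ← Finset.sum_sub_distrib, jacobiPoly, Finset.smul_sum]
    refine Finset.sum_congr rfl fun k _ => ?_
    rw [← sub_mul, ← C_sub, smul_eq_C_mul, ← mul_assoc (C ((2 * (n : ℝ) + s + c + 2) ^ 2)),
      ← C_mul]
    congr 2
    have h := jacobiCoeff_succ_mul n (s + 1) c k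
    rw [← hq] at h ⊢
    linear_combination (-4) * h
  rw [hpoly, map_smul, real_smul_radialL2] at hsum
  exact hsum

theorem radialEigenvalue_injective {κ M lam : ℝ} (s : ℕ) :
    Function.Injective (radialEigenvalue κ M s lam) := by
  intro i j h
  have hc : 0 ≤ radialC κ M lam := Real.sqrt_nonneg _
  have h' := (pow_left_inj₀ (by positivity) (by positivity) two_ne_zero).1 h
  have : (i : ℝ) = j := by linarith
  exact_mod_cast this

/-- No integral is computed: these are eigenvectors of a symmetric operator for distinct
eigenvalues. -/
theorem inner_radialPoly_jacobiPoly_of_ne {κ M lam : ℝ} (hκ : 0 < κ) (hlam : 0 ≤ lam) (s : ℕ)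
    {i j : ℕ} (hij : i ≠ j) :
    inner ℂ (radialPoly s (three_le_two_add (two_le_radialC (M := M) hκ hlam))
        (jacobiPoly i (s + 1) (radialC κ M lam)))
      (radialPoly s (three_le_two_add (two_le_radialC (M := M) hκ hlam))
        (jacobiPoly j (s + 1) (radialC κ M lam))) = 0 := by
  have hd := dense_domain_radialOp κ M s lam
  have hA := isFormalAdjoint_radialOp κ M s lam
  have hmem := fun n => radialPoly_jacobiPoly_mem_closure_graph s n
    (two_le_radialC (M := M) hκ hlam) (radialC_indicial hκ hlam)
  rw [(hA.isClosable hd).graph_closure_eq_closure_graph] at hmem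
  exact (hA.closure hd).inner_eq_zero (hmem i) (hmem j) fun h =>
    hij (radialEigenvalue_injective (κ := κ) (M := M) (lam := lam) s h)

theorem jacobiCoeff_self_ne_zero (n : ℕ) {a b : ℝ} (h : 0 < n + a + b + 1) :
    jacobiCoeff n a b n ≠ 0 := by
  rw [jacobiCoeff_self]
  have := (ascPochhammer_pos n _ h).ne'
  positivity

/-- The polynomials `J n` and `r (1-X)^n` have the same leading coefficient, so they differ by a
combination of lower Jacobi polynomials, orthogonal to `J n`. Hence the squared norm is `r` times
the inner product with `(1-X)^n`. -/
theorem inner_jacobiPoly_self {κ M lam : ℝ} (hκ : 0 < κ) (hlam : 0 ≤ lam) (s n : ℕ) {c : ℝ}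
    (hc : c = radialC κ M lam) (h2 : 2 ≤ c) :
    inner ℂ (radialPoly s (three_le_two_add h2) (jacobiPoly n (s + 1) c))
      (radialPoly s (three_le_two_add h2) (jacobiPoly n (s + 1) c)) =
      (((n + s + 1).factorial * Real.Gamma (n + c + 1) /
        ((2 * n + s + c + 2) * n.factorial * Real.Gamma (n + s + c + 2)) : ℝ) : ℂ) := by
  set T := radialPoly s (three_le_two_add h2) with hT
  set J := fun n : ℕ => jacobiPoly n ((s : ℝ) + 1) c with hJ
  set z : ℝ := n + s + c + 2 with hz
  have hz0 : 0 < z := by positivity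
  have hpo := ascPochhammer_pos n z hz0
  set r : ℝ := (ascPochhammer ℝ n).eval z / n.factorial with hr
  have hr0 : r ≠ 0 := by positivity
  have hlead : jacobiCoeff n ((s : ℝ) + 1) c n = (-1) ^ n * r := by
    rw [jacobiCoeff_self, hr, hz]
    ring_nf
  -- The real polynomials whose image is orthogonal to that of `J n`.
  set V : Submodule ℝ ℝ[X] := ((Submodule.span ℂ {T (J n)})ᗮ.restrictScalars ℝ).comap T with hV
  have hlow : J n - r • (1 - X) ^ n ∈ V := by
    refine Polynomial.mem_of_forall_coeff_eq_zero (J := J) (n := n) (fun i => ?_)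
      (fun i k hik => ?_) (fun i hi => ?_) _ fun k hk => ?_
    · rw [hJ, coeff_jacobiPoly]
      exact jacobiCoeff_self_ne_zero i (by positivity)
    · rw [hJ, coeff_jacobiPoly, jacobiCoeff_eq_zero _ _ hik]
    · rw [hV, Submodule.mem_comap, Submodule.restrictScalars_mem,
        Submodule.mem_orthogonal_singleton_iff_inner_right]
      subst hc
      exact inner_radialPoly_jacobiPoly_of_ne hκ hlam s hi.ne'
    · have hX : (1 - X : ℝ[X]) ^ n = (-1) ^ n * (X - C 1) ^ n := by
        rw [← mul_pow, C_1]
        congr 1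
        ring
      have hdeg : ((X - C 1 : ℝ[X]) ^ n).natDegree = n := by
        rw [natDegree_pow, natDegree_X_sub_C, mul_one]
      have hX' : ((1 - X : ℝ[X]) ^ n).coeff k = (-1) ^ n * ((X - C 1 : ℝ[X]) ^ n).coeff k := by
        rw [hX, show ((-1 : ℝ[X]) ^ n) = C ((-1) ^ n) by simp, coeff_C_mul]
      rw [coeff_sub, coeff_smul, hX', hJ, coeff_jacobiPoly, smul_eq_mul]
      rcases hk.eq_or_lt with rfl | hk
      · have h1 : ((X - C 1 : ℝ[X]) ^ n).coeff n = 1 := by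
          have h := ((monic_X_sub_C (1 : ℝ)).pow n).coeff_natDegree
          rwa [hdeg] at h
        rw [hlead, h1]
        ring
      · rw [jacobiCoeff_eq_zero _ _ hk, coeff_eq_zero_of_natDegree_lt (hdeg.trans_lt hk)]
        ring
  rw [hV, Submodule.mem_comap, Submodule.restrictScalars_mem,
    Submodule.mem_orthogonal_singleton_iff_inner_right, map_sub, inner_sub_right, map_smul,
    real_smul_radialL2, inner_smul_right, sub_eq_zero] at hlow
  refine hlow.trans ?_
  rw [hJ, hT, inner_jacobiPoly_one_sub_X_pow s n h2, ← hz, ← Complex.ofReal_mul]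
  congr 1
  have hg := (Real.Gamma_pos_of_pos hz0).ne'
  have hzn : 0 < z + n := by positivity
  rw [hr, ascPochhammer_succ_eval, show 2 * (n : ℝ) + s + c + 2 = z + n by rw [hz]; ring,
    show s + 1 + n = n + s + 1 by ring, add_comm c n]
  field_simp

end Eigenfunctions

/-! ### Assembly of the spectral decomposition. -/

theorem lemma4p1 (κ M : ℝ) (hκ : 0 < κ) (hM : 0 ≤ M) (s : ℕ) (lam : ℝ) (hlam : 0 ≤ lam) :
    IsEssentiallySelfAdjoint (radialOp κ M s lam) ∧
    (∃! Φ : (ℝ≥0 →ᵇ ℂ) →⋆ₐ[ℂ] (RadialL2 →L[ℂ] RadialL2),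
      IsFunctionalCalculus (radialOp κ M s lam).closure Φ) ∧
    ∃ b : HilbertBasis ℕ ℂ RadialL2,
      (∀ i : ℕ, (b i : ℝ → ℂ) =ᵐ[radialMeasure]
        (fun x => (radialEigenfunction κ M s lam i x : ℂ))) ∧
      (∀ i : ℕ, ∃ h : b i ∈ (radialOp κ M s lam).closure.domain,
        (radialOp κ M s lam).closure ⟨b i, h⟩ = (radialEigenvalue κ M s lam i : ℂ) • b i) ∧
      (∀ Φ : (ℝ≥0 →ᵇ ℂ) →⋆ₐ[ℂ] (RadialL2 →L[ℂ] RadialL2),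
        IsFunctionalCalculus (radialOp κ M s lam).closure Φ →
        ∀ (F : ℝ≥0 →ᵇ ℂ) (f : RadialL2),
          HasSum (fun i : ℕ =>
            (F (radialEigenvalue κ M s lam i).toNNReal *
              ∫ x, f x * (starRingEnd ℂ) (radialEigenfunction κ M s lam i x : ℂ) ∂radialMeasure)
                • b i)
            (Φ F f)) := by
  have hc := two_le_radialC (M := M) hκ hlam
  have hd := dense_domain_radialOp κ M s lam
  have hA := isFormalAdjoint_radialOp κ M s lam
  set T := radialPoly s (three_le_two_add hc) with hT
  set J := fun i : ℕ => jacobiPoly i ((s : ℝ) + 1) (radialC κ M lam) with hJ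
  set N := fun i : ℕ => √((2 * i + s + radialC κ M lam + 2) * i.factorial
      * Real.Gamma (i + s + radialC κ M lam + 2)
      / ((i + s + 1).factorial * Real.Gamma (i + radialC κ M lam + 1))) with hN
  have hg1 : ∀ i : ℕ, 0 < Real.Gamma (i + s + radialC κ M lam + 2) := fun i =>
    Real.Gamma_pos_of_pos (by positivity)
  have hg2 : ∀ i : ℕ, 0 < Real.Gamma (i + radialC κ M lam + 1) := fun i =>
    Real.Gamma_pos_of_pos (by positivity)
  have hN0 : ∀ i, N i ≠ 0 := fun i => by
    have := hg1 i
    have := hg2 i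
    exact (Real.sqrt_pos.2 (by positivity)).ne'
  set v := fun i : ℕ => (N i : ℂ) • T (J i) with hv
  have horth : Orthonormal ℂ v := by
    constructor
    · intro i
      have h := inner_jacobiPoly_self hκ hlam s i rfl hc
      have h1 : inner ℂ (v i) (v i) = 1 := by
        rw [hv, inner_smul_left, inner_smul_right, h, Complex.conj_ofReal, ← Complex.ofReal_mul,
          ← Complex.ofReal_mul, ← mul_assoc, ← sq, hN, Real.sq_sqrt (by
            have := hg1 i
            have := hg2 i
            positivity)]
        have := (hg1 i).ne'
        have := (hg2 i).ne'
        have : 2 * (i : ℝ) + s + radialC κ M lam + 2 ≠ 0 := by positivity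
        rw [← Complex.ofReal_one]
        congr 1
        field_simp
      rw [inner_self_eq_norm_sq_to_K] at h1
      have h2 : ‖v i‖ ^ 2 = 1 := Complex.ofReal_injective (by simpa using h1)
      exact (pow_eq_one_iff_of_nonneg (norm_nonneg _) two_ne_zero).1 h2
    · intro i j hij
      rw [hv, inner_smul_left, inner_smul_right, inner_radialPoly_jacobiPoly_of_ne hκ hlam s hij,
        mul_zero, mul_zero]
  -- There is one Jacobi polynomial of each degree, so the span of the `v i` contains the images of
  -- all real polynomials, and density applies.
  have hspan : ⊤ ≤ (Submodule.span ℂ (range v)).topologicalClosure := by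
    refine (topologicalClosure_eq_top_of_radialPoly_mem s (three_le_two_add hc) fun P => ?_).ge
    refine Polynomial.mem_of_forall_coeff_eq_zero (J := J) (n := P.natDegree + 1)
      (V := ((Submodule.span ℂ (range v)).restrictScalars ℝ).comap T) (fun i => ?_)
      (fun i k hik => ?_) (fun i hi => ?_) P fun k hk =>
        Polynomial.coeff_eq_zero_of_natDegree_lt (by omega)
    · rw [hJ, coeff_jacobiPoly]
      exact jacobiCoeff_self_ne_zero i (by positivity)
    · rw [hJ, coeff_jacobiPoly, jacobiCoeff_eq_zero _ _ hik]
    · have h := Submodule.smul_mem _ ((N i : ℂ)⁻¹)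
        (Submodule.subset_span (R := ℂ) (mem_range_self (f := v) i))
      rwa [hv, inv_smul_smul₀ (by exact_mod_cast hN0 i)] at h
  set b : HilbertBasis ℕ ℂ RadialL2 := HilbertBasis.mk horth hspan with hb
  have hbv : ∀ i, b i = (N i : ℂ) • T (J i) := fun i => by rw [hb, HilbertBasis.coe_mk]
  have hgraph : ∀ i, (b i, (radialEigenvalue κ M s lam i : ℂ) • b i) ∈
      (radialOp κ M s lam).closure.graph := by
    intro i
    rw [← (hA.isClosable hd).graph_closure_eq_closure_graph, hbv, smul_comm]
    exact Submodule.smul_mem _ (N i : ℂ)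
      (radialPoly_jacobiPoly_mem_closure_graph s i hc (radialC_indicial hκ hlam))
  have hgraph' : ∀ i, (b i, (((radialEigenvalue κ M s lam i).toNNReal : ℝ) : ℂ) • b i) ∈
      (radialOp κ M s lam).closure.graph := by
    intro i
    -- The eigenvalue is a square, so truncation to `ℝ≥0` does not change it.
    rw [Real.coe_toNNReal (radialEigenvalue κ M s lam i) (sq_nonneg _)]
    exact hgraph i
  have hae : ∀ i, (b i : ℝ → ℂ) =ᵐ[radialMeasure]
      (fun x => (radialEigenfunction κ M s lam i x : ℂ)) := by
    intro i
    rw [hbv]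
    filter_upwards [Lp.coeFn_smul (N i : ℂ) (T (J i)),
      coeFn_radialPoly s (three_le_two_add hc) (J i)] with x h1 h2
    rw [h1, Pi.smul_apply, h2, smul_eq_mul, ← Complex.ofReal_mul, radialEigenfunction,
      jacobiP_neg_cos_two_mul, radialMode]
    congr 1
    ring
  refine ⟨isEssentiallySelfAdjoint_of_hilbertBasis hd hA b _ hgraph,
    existsUnique_isFunctionalCalculus hd hA b _ hgraph', b, hae,
    fun i => LinearPMap.exists_apply_eq_of_mem_graph (hgraph i), fun Φ hΦ F f => ?_⟩
  refine (hΦ.hasSum b _ hgraph' F f).congr_fun fun i => ?_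
  congr 2
  rw [L2.inner_def]
  refine integral_congr_ae ?_
  filter_upwards [hae i] with x hx
  rw [hx, RCLike.inner_apply]
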